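/- Let $(B^n,g_B)$ and $(F^m,g_F)$ be connected smooth Riemannian manifolds without boundary, let $f:B\to(0,\infty)$ be a smooth nonconstant function, and let $g=\pi_B^*g_B+(f\circ\pi_B)^2\,\pi_F^*g_F$ be the warped product metric on $M=B\times F$. Suppose that $g$ is a gradient Einstein-type metric with $\beta\neq 0$, that is: $g$ is geodesically complete, and there are real constants $\alpha,\beta,\mu,\rho$ with $\beta\neq0$ and smooth functions $h,\lambda:M\to\mathbb R$ (the potential function and the soliton function) such that $$\alpha\,\mathrm{Ric}_g+\beta\,\nabla^2h+\mu\,dh\otimes dh=(\rho R_g+\lambda)\,g\quad\text{on } M,$$ where $\mathrm{Ric}_g$ and $R_g$ are the Ricci tensor and the scalar curvature of $g$, and $\nabla^2h$ is the Hessian of $h$ with respect to $g$. Let $R_{g_F}$ be the scalar curvature of $g_F$, and say that a function $\varphi$ on $B\times F$ is the lift of a smooth function on $B$ if there is a smooth function $k:B\to\mathbb R$ with $\varphi(x,y)=k(x)$ for all $(x,y)\in B\times F$. Then: (a) If $\mu=0$, then $h$ is the lift of a smooth function on $B$ if and only if the function $(x,y)\mapsto\rho R_{g_F}(y)+\lambda(x,y)f(x)^2$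 is the lift of a smooth function on $B$. (b) If $\mu\neq0$ and $h$ is the lift of a smooth function on $B$, then the function $(x,y)\mapsto\rho R_{g_F}(y)+\lambda(x,y)f(x)^2$ is also the lift of a smooth function on $B$. -/

import Mathlib

set_option maxSynthPendingDepth 3

open scoped Manifold ContDiff Topology

/-! ### Tensor calculus of a field of bilinear forms on a finite-dimensional vector space -/

namespace CoordMetric

variable {E : Type*} [NormedAddCommGroup E] [NormedSpace ℝ E]

/-- Christoffel symbols of the first kind:
`K(u, v)(w) = (∂_u g(v, w) + ∂_v g(u, w) - ∂_w g(u, v)) / 2`. -/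
noncomputable def christoffelLower (G : E → E →L[ℝ] E →L[ℝ] ℝ) (y : E) :
    E →L[ℝ] E →L[ℝ] E →L[ℝ] ℝ :=
  (1 / 2 : ℝ) • (fderiv ℝ G y + (fderiv ℝ G y).flip -
    (ContinuousLinearMap.flipₗᵢ ℝ E E ℝ : (E →L[ℝ] E →L[ℝ] ℝ) →L[ℝ] E →L[ℝ] E →L[ℝ] ℝ).comp
      (fderiv ℝ G y).flip)

theorem christoffelLower_apply (G : E → E →L[ℝ] E →L[ℝ] ℝ) (y u v w : E) :
    christoffelLower G y u v w =
      (1 / 2) * (fderiv ℝ G y u v w + fderiv ℝ G y v u w - fderiv ℝ G y w u v) := by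
  simp [christoffelLower]

/-- Christoffel symbols of the second kind `Γ(u, v)`, obtained from `K(u, v)` by raising the
index with the inverse of `g`. -/
noncomputable def christoffel (G : E → E →L[ℝ] E →L[ℝ] ℝ) (y : E) : E →L[ℝ] E →L[ℝ] E :=
  (ContinuousLinearMap.compL ℝ E (E →L[ℝ] ℝ) E (G y).inverse) ∘L christoffelLower G y

theorem christoffel_apply (G : E → E →L[ℝ] E →L[ℝ] ℝ) (y u v : E) :
    christoffel G y u v = (G y).inverse (christoffelLower G y u v) := rfl

/-- The endomorphism `u ↦ R(u, v) w` given by the Riemann curvature tensor. -/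
noncomputable def curvature (G : E → E →L[ℝ] E →L[ℝ] ℝ) (y v w : E) : E →L[ℝ] E :=
  ((fderiv ℝ (christoffel G) y).flip v).flip w - (fderiv ℝ (christoffel G) y v).flip w
    + (christoffel G y).flip (christoffel G y v w)
    - (christoffel G y v) ∘L ((christoffel G y).flip w)

theorem curvature_apply (G : E → E →L[ℝ] E →L[ℝ] ℝ) (y u v w : E) :
    curvature G y v w u =
      fderiv ℝ (christoffel G) y u v w - fderiv ℝ (christoffel G) y v u w
        + christoffel G y u (christoffel G y v w) - christoffel G y v (christoffel G y u w) := rfl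

/-- The Ricci tensor `Ric(v, w) = tr (u ↦ R(u, v) w)`. -/
noncomputable def ricci (G : E → E →L[ℝ] E →L[ℝ] ℝ) (y : E) : E →ₗ[ℝ] E →ₗ[ℝ] ℝ :=
  LinearMap.mk₂ ℝ (fun v w => LinearMap.trace ℝ E (curvature G y v w).toLinearMap)
    (fun v v' w => by
      rw [← map_add]; congr 1; ext u; simp [curvature_apply]; abel)
    (fun c v w => by
      rw [← map_smul]; congr 1; ext u; simp [curvature_apply, smul_sub, smul_add])
    (fun v w w' => by
      rw [← map_add]; congr 1; ext u; simp [curvature_apply]; abel)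
    (fun c v w => by
      rw [← map_smul]; congr 1; ext u; simp [curvature_apply, smul_sub, smul_add])

theorem ricci_apply (G : E → E →L[ℝ] E →L[ℝ] ℝ) (y v w : E) :
    ricci G y v w = LinearMap.trace ℝ E (curvature G y v w).toLinearMap := rfl

/-- The scalar curvature: the trace with respect to `g` of the Ricci tensor, that is, the trace
of the endomorphism `g⁻¹ ∘ Ric`. -/
noncomputable def scalar [FiniteDimensional ℝ E] (G : E → E →L[ℝ] E →L[ℝ] ℝ) (y : E) : ℝ :=
  LinearMap.trace ℝ E
    ((G y).inverse.toLinearMap ∘ₗ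
      (LinearMap.toContinuousLinearMap : (E →ₗ[ℝ] ℝ) ≃ₗ[ℝ] (E →L[ℝ] ℝ)).toLinearMap ∘ₗ ricci G y)

/-- The Hessian `∂_u ∂_v h - dh(Γ(u, v))`. -/
noncomputable def hessian (G : E → E →L[ℝ] E →L[ℝ] ℝ) (h : E → ℝ) (y u v : E) : ℝ :=
  fderiv ℝ (fderiv ℝ h) y u v - fderiv ℝ h y (christoffel G y u v)

end CoordMetric

/-! ### Riemannian manifolds (without boundary) -/

namespace Riem

/-- Smooth Riemannian metrics on the tangent bundle of `M`. -/
abbrev Metric {E : Type*} [NormedAddCommGroup E] [NormedSpace ℝ E]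
    {H : Type*} [TopologicalSpace H] (I : ModelWithCorners ℝ E H)
    (M : Type*) [TopologicalSpace M] [ChartedSpace H M] [IsManifold I ∞ M] : Type _ :=
  Bundle.ContMDiffRiemannianMetric I ∞ E (fun x : M => TangentSpace I x)

section Manifold

variable {E : Type*} [NormedAddCommGroup E] [NormedSpace ℝ E]
  {H : Type*} [TopologicalSpace H] {I : ModelWithCorners ℝ E H}
  {M : Type*} [TopologicalSpace M] [ChartedSpace H M]

/-- The pull-back `(u, v) ↦ b(A u, A v)` of a bilinear form. -/
noncomputable def pullForm {V W : Type*} [AddCommGroup V] [Module ℝ V] [TopologicalSpace V]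
    [IsTopologicalAddGroup V] [ContinuousConstSMul ℝ V]
    [AddCommGroup W] [Module ℝ W] [TopologicalSpace W]
    [IsTopologicalAddGroup W] [ContinuousConstSMul ℝ W]
    (b : W →L[ℝ] W →L[ℝ] ℝ) (A : V →L[ℝ] W) : V →L[ℝ] V →L[ℝ] ℝ :=
  (ContinuousLinearMap.precomp ℝ A) ∘L (b ∘L A)

@[simp]
theorem pullForm_apply {V W : Type*} [AddCommGroup V] [Module ℝ V] [TopologicalSpace V]
    [IsTopologicalAddGroup V] [ContinuousConstSMul ℝ V]
    [AddCommGroup W] [Module ℝ W] [TopologicalSpace W]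
    [IsTopologicalAddGroup W] [ContinuousConstSMul ℝ W]
    (b : W →L[ℝ] W →L[ℝ] ℝ) (A : V →L[ℝ] W) (u v : V) :
    pullForm b A u v = b (A u) (A v) := rfl

variable [IsManifold I ∞ M]

/-- The metric `g` read in the chart at `p`. -/
noncomputable def inChart (g : Metric I M) (p : M) (y : E) : E →L[ℝ] E →L[ℝ] ℝ :=
  pullForm (g.inner ((extChartAt I p).symm y)) (mfderiv 𝓘(ℝ, E) I (extChartAt I p).symm y)

/-- The components in `E` of a tangent vector at `p`, in the chart at `p`. -/
noncomputable def components (p : M) : TangentSpace I p →L[ℝ] E :=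
  mfderiv I 𝓘(ℝ, E) (extChartAt I p) p

/-- The Ricci tensor of `g` at `p`, computed in the chart at `p`. -/
noncomputable def ricci (g : Metric I M) (p : M) (u v : TangentSpace I p) : ℝ :=
  CoordMetric.ricci (inChart g p) (extChartAt I p p) (components p u) (components p v)

/-- The scalar curvature of `g` at `p`, computed in the chart at `p`. -/
noncomputable def scalar [FiniteDimensional ℝ E] (g : Metric I M) (p : M) : ℝ :=
  CoordMetric.scalar (inChart g p) (extChartAt I p p)

/-- The Hessian of `h` with respect to `g` at `p`, computed in the chart at `p`. -/
noncomputable def hessian (g : Metric I M) (h : M → ℝ) (p : M) (u v : TangentSpace I p) : ℝ :=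
  CoordMetric.hessian (inChart g p) (h ∘ (extChartAt I p).symm) (extChartAt I p p)
    (components p u) (components p v)

/-- The differential of a real function at `p`. -/
noncomputable def differential (I : ModelWithCorners ℝ E H) (h : M → ℝ) (p : M)
    (u : TangentSpace I p) : ℝ :=
  mfderiv I 𝓘(ℝ, ℝ) h p u

/-- `γ : ℝ → M` is a geodesic of `g`: it is smooth, and at every time `t` its coordinates `c` in
the chart at `γ t` satisfy `c'' + Γ(c', c') = 0`. -/
def IsGeodesic (g : Metric I M) (γ : ℝ → M) : Prop :=
  ContMDiff 𝓘(ℝ, ℝ) I ∞ γ ∧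
    ∀ t : ℝ,
      deriv (deriv (extChartAt I (γ t) ∘ γ)) t +
        CoordMetric.christoffel (inChart g (γ t)) (extChartAt I (γ t) (γ t))
          (deriv (extChartAt I (γ t) ∘ γ) t) (deriv (extChartAt I (γ t) ∘ γ) t) = 0

/-- The velocity of the curve `γ` at time `t`. -/
noncomputable def velocity (I : ModelWithCorners ℝ E H) (γ : ℝ → M) (t : ℝ) :
    TangentSpace I (γ t) :=
  mfderiv 𝓘(ℝ, ℝ) I γ t (1 : ℝ)

/-- Geodesic completeness: every tangent vector is the initial velocity of a geodesic that is
defined on the whole of `ℝ`. -/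
def IsGeodesicallyComplete (g : Metric I M) : Prop :=
  ∀ v : TangentBundle I M, ∃ γ : ℝ → M, IsGeodesic g γ ∧
    (⟨γ 0, velocity I γ 0⟩ : TangentBundle I M) = v

/-- `g` is a gradient Einstein-type metric with constants `α, β, μ, ρ`, potential function `h` and
soliton function `lam`. -/
structure IsGradientEinsteinType [FiniteDimensional ℝ E] (g : Metric I M) (α β μ ρ : ℝ)
    (h lam : M → ℝ) : Prop where
  complete : IsGeodesicallyComplete g
  nontrivial : (α, β, μ) ≠ (0, 0, 0)
  smooth_potential : ContMDiff I 𝓘(ℝ, ℝ) ∞ h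
  smooth_soliton : ContMDiff I 𝓘(ℝ, ℝ) ∞ lam
  equation : ∀ (p : M) (u v : TangentSpace I p),
    α * ricci g p u v + β * hessian g h p u v
        + μ * (differential I h p u * differential I h p v)
      = (ρ * scalar g p + lam p) * g.inner p u v

end Manifold

/-! ### Warped products -/

section Warped

variable {E₁ : Type*} [NormedAddCommGroup E₁] [NormedSpace ℝ E₁]
  {H₁ : Type*} [TopologicalSpace H₁] {I₁ : ModelWithCorners ℝ E₁ H₁}
  {B : Type*} [TopologicalSpace B] [ChartedSpace H₁ B] [IsManifold I₁ ∞ B]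
  {E₂ : Type*} [NormedAddCommGroup E₂] [NormedSpace ℝ E₂]
  {H₂ : Type*} [TopologicalSpace H₂] {I₂ : ModelWithCorners ℝ E₂ H₂}
  {F : Type*} [TopologicalSpace F] [ChartedSpace H₂ F] [IsManifold I₂ ∞ F]

/-- The bilinear form `π_B^* g_B + f² π_F^* g_F` at the point `p` of `B × F`. -/
noncomputable def warpedForm (gB : Metric I₁ B) (f : B → ℝ) (gF : Metric I₂ F) (p : B × F) :
    TangentSpace (I₁.prod I₂) p →L[ℝ] TangentSpace (I₁.prod I₂) p →L[ℝ] ℝ :=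
  pullForm (gB.inner p.1) (mfderiv (I₁.prod I₂) I₁ Prod.fst p) +
    (f p.1) ^ 2 • pullForm (gF.inner p.2) (mfderiv (I₁.prod I₂) I₂ Prod.snd p)

theorem warpedForm_apply (gB : Metric I₁ B) (f : B → ℝ) (gF : Metric I₂ F) (p : B × F)
    (u v : TangentSpace (I₁.prod I₂) p) :
    warpedForm gB f gF p u v =
      gB.inner p.1 (mfderiv (I₁.prod I₂) I₁ Prod.fst p u) (mfderiv (I₁.prod I₂) I₁ Prod.fst p v) +
      (f p.1) ^ 2 * gF.inner p.2 (mfderiv (I₁.prod I₂) I₂ Prod.snd p u)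
        (mfderiv (I₁.prod I₂) I₂ Prod.snd p v) := rfl

theorem contMDiff_pullForm {E : Type*} [NormedAddCommGroup E] [NormedSpace ℝ E]
    {H : Type*} [TopologicalSpace H] {I : ModelWithCorners ℝ E H}
    {M : Type*} [TopologicalSpace M] [ChartedSpace H M] [IsManifold I ∞ M]
    (g : Metric I₁ B) {φ : M → B} (hφ : ContMDiff I I₁ ∞ φ) :
    ContMDiff I (I.prod 𝓘(ℝ, E →L[ℝ] E →L[ℝ] ℝ)) ∞
      (fun p : M => Bundle.TotalSpace.mk' (E →L[ℝ] E →L[ℝ] ℝ)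
        (E := fun x : M => TangentSpace I x →L[ℝ] TangentSpace I x →L[ℝ] ℝ) p
        (pullForm (g.inner (φ p)) (mfderiv I I₁ φ p))) := by
  intro x₀
  rw [contMDiffAt_hom_bundle]
  refine ⟨contMDiffAt_id, ?_⟩
  have hD := (hφ x₀).mfderiv_const (x₀ := x₀) (m := ∞) (by simp)
  have hG : ContMDiffAt I 𝓘(ℝ, E₁ →L[ℝ] E₁ →L[ℝ] ℝ) ∞ (fun x => ContinuousLinearMap.inCoordinates
      E₁ (TangentSpace I₁) (E₁ →L[ℝ] ℝ) (fun b : B => TangentSpace I₁ b →L[ℝ] ℝ)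
      (φ x₀) (φ x) (φ x₀) (φ x) (g.inner (φ x))) x₀ :=
    ((contMDiffAt_hom_bundle _).1 ((g.contMDiff (φ x₀)).comp x₀ (hφ x₀))).2
  have key := hG.clm_comp hD
  have key2 := (hD.clm_precomp (F₃ := ℝ)).clm_comp key
  refine key2.congr_of_eventuallyEq ?_
  have h1 := (trivializationAt E (TangentSpace I) x₀).open_baseSet.mem_nhds
    (FiberBundle.mem_baseSet_trivializationAt' x₀)
  have h2 := hφ.continuous.continuousAt.preimage_mem_nhds
    ((trivializationAt E₁ (TangentSpace I₁) (φ x₀)).open_baseSet.mem_nhds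
    (FiberBundle.mem_baseSet_trivializationAt' (φ x₀)))
  filter_upwards [h1, h2] with x hx hx'
  have hx'' : φ x ∈ (trivializationAt E₁ (TangentSpace I₁) (φ x₀)).baseSet := hx'
  ext u v
  rw [inCoordinates_apply_eq₂ hx hx (by simp)]
  simp only [ContinuousLinearMap.comp_apply, ContinuousLinearMap.precomp_apply]
  rw [inCoordinates_apply_eq₂ hx'' hx'' (by simp)]
  have hlin : ∀ w : E, (trivializationAt E₁ (TangentSpace I₁) (φ x₀)).symm (φ x)
      ((inTangentCoordinates I I₁ id φ (mfderiv I I₁ φ) x₀ x) w) =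
      mfderiv I I₁ φ x ((trivializationAt E (TangentSpace I) x₀).symm x w) := by
    intro w
    unfold inTangentCoordinates
    rw [ContinuousLinearMap.inCoordinates_eq (by simpa using hx) hx'']
    simp [Bundle.Trivialization.symm_apply_apply_mk _ hx'']
  rw [hlin, hlin]
  simp

theorem warpedForm_contMDiff (gB : Metric I₁ B) (f : B → ℝ) (hf : ContMDiff I₁ 𝓘(ℝ, ℝ) ∞ f)
    (gF : Metric I₂ F) :
    ContMDiff (I₁.prod I₂) ((I₁.prod I₂).prod 𝓘(ℝ, (E₁ × E₂) →L[ℝ] (E₁ × E₂) →L[ℝ] ℝ)) ∞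
      (fun p : B × F => Bundle.TotalSpace.mk' ((E₁ × E₂) →L[ℝ] (E₁ × E₂) →L[ℝ] ℝ)
        (E := fun p : B × F =>
          TangentSpace (I₁.prod I₂) p →L[ℝ] TangentSpace (I₁.prod I₂) p →L[ℝ] ℝ) p
        (warpedForm gB f gF p)) := by
  have h1 := contMDiff_pullForm gB (contMDiff_fst (I := I₁) (J := I₂) (M := B) (N := F) (n := ∞))
  have h2 := contMDiff_pullForm gF (contMDiff_snd (I := I₁) (J := I₂) (M := B) (N := F) (n := ∞))
  have h3 : ContMDiff (I₁.prod I₂) 𝓘(ℝ, ℝ) ∞ (fun p : B × F => (f p.1) ^ 2) :=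
    (hf.comp contMDiff_fst).pow 2
  exact h1.add_section (h3.smul_section h2)

theorem metric_self_nonneg (g : Metric I₁ B) (x : B) (a : TangentSpace I₁ x) :
    0 ≤ g.inner x a a := by
  rcases eq_or_ne a 0 with rfl | ha
  · simp
  · exact (g.pos x a ha).le

open scoped Pointwise in
/-- The warped metric `g_B + f² g_F` on `B × F`. -/
noncomputable def warpedMetric (gB : Metric I₁ B) (f : B → ℝ) (hf : ContMDiff I₁ 𝓘(ℝ, ℝ) ∞ f) (hpos : ∀ x, 0 < f x)
    (gF : Metric I₂ F) : Metric (I₁.prod I₂) (B × F) where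
  inner := warpedForm gB f gF
  symm p u v := by
    rw [warpedForm_apply, warpedForm_apply, gB.symm, gF.symm]
  pos p v hv := by
    rw [warpedForm_apply, mfderiv_fst, mfderiv_snd]
    have key : ∀ (a : TangentSpace I₁ p.1) (b : TangentSpace I₂ p.2), (a ≠ 0 ∨ b ≠ 0) →
        0 < gB.inner p.1 a a + f p.1 ^ 2 * gF.inner p.2 b b := by
      intro a b hab
      rcases hab with ha | hb
      · exact add_pos_of_pos_of_nonneg (gB.pos _ a ha)
          (mul_nonneg (sq_nonneg _) (metric_self_nonneg gF p.2 b))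
      · exact add_pos_of_nonneg_of_pos (metric_self_nonneg gB p.1 a)
          (mul_pos (pow_pos (hpos _) 2) (gF.pos _ b hb))
    refine key v.1 v.2 ?_
    by_contra! h
    exact hv (Prod.ext h.1 h.2)
  isVonNBounded p := by
    have hfp := hpos p.1
    have h1 : Bornology.IsVonNBounded ℝ {a : E₁ | gB.inner p.1 a a < 1} := gB.isVonNBounded p.1
    have h2 : Bornology.IsVonNBounded ℝ {b : E₂ | gF.inner p.2 b b < 1} := gF.isVonNBounded p.2
    rw [NormedSpace.isVonNBounded_iff] at h1 h2
    have h3 := h1.prod (h2.smul₀ (f p.1)⁻¹)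
    rw [← NormedSpace.isVonNBounded_iff ℝ] at h3
    refine Bornology.IsVonNBounded.subset ?_ h3
    intro v hv
    have hv' : warpedForm gB f gF p v v < 1 := hv
    rw [warpedForm_apply, mfderiv_fst, mfderiv_snd] at hv'
    have key : ∀ (a : TangentSpace I₁ p.1) (b : TangentSpace I₂ p.2),
        gB.inner p.1 a a + f p.1 ^ 2 * gF.inner p.2 b b < 1 →
        gB.inner p.1 a a < 1 ∧ gF.inner p.2 (f p.1 • b) (f p.1 • b) < 1 := by
      intro a b hab
      have ha := metric_self_nonneg gB p.1 a
      have hb := mul_nonneg (sq_nonneg (f p.1)) (metric_self_nonneg gF p.2 b)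
      refine ⟨by linarith, ?_⟩
      simp only [map_smul, _root_.smul_apply, smul_eq_mul]
      linarith [sq (f p.1), mul_assoc (f p.1) (f p.1) (gF.inner p.2 b b)]
    obtain ⟨ha, hb⟩ := key v.1 v.2 hv'
    refine ⟨ha, ?_⟩
    exact (Set.mem_inv_smul_set_iff₀ hfp.ne' _ _).2 hb
  contMDiff := warpedForm_contMDiff gB f hf gF

/-- A function on `B × F` is the lift to the product of a smooth function on `B`. -/
def IsLiftOfSmooth (I₁ : ModelWithCorners ℝ E₁ H₁) (φ : B × F → ℝ) : Prop :=
  ∃ k : B → ℝ, ContMDiff I₁ 𝓘(ℝ, ℝ) ∞ k ∧ ∀ (x : B) (y : F), φ (x, y) = k x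

end Warped

end Riem

/-! In a warped product every curvature quantity splits into a base part and a fibre part. The Ricci
tensor and the metric have no mixed components, and `f² R_g = R_F + (a function on B)`. Testing the
structure equation on two kinds of vectors then gives everything.

On horizontal vectors (`IsGradientEinsteinType.horizontal`) the left side depends on the fibre point
only through `h`. If `h` is a lift, `ρ R_g + λ` is therefore independent of the fibre point, and
multiplying by `f²` gives the same for `ρ R_F + λ f²`. This works for every `μ`.

For the converse, `μ = 0` and `β ≠ 0` make the mixed equation say that the mixed Hessian of `h`
vanishes. This means that (vertical derivative of `h`) / `f` does not vary along `B`, so `h(x, y) =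
h(x, y₀) + f(x) ψ(y)` (`IsGradientEinsteinType.exists_potential_eq`). If `ψ(y₁) ≠ 0`, subtracting
the horizontal equations at `y₁` and `y₀` leaves `β ψ(y₁) ∇²f = 0`
(`IsGradientEinsteinType.hessian_eq_zero`). A nonconstant `f` with zero Hessian is affine with
nonzero slope along a suitable complete horizontal geodesic, hence vanishes somewhere, against `f >
0` (`not_isGeodesicallyComplete_of_hessian_eq_zero`). So `ψ = 0` and `h` is a lift.

A geodesic with horizontal initial velocity stays horizontal because `f⁴ g_F(γ₂', γ₂')` is
conserved, a Clairaut-type integral; uniqueness of geodesics is not needed. -/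

namespace CoordMetric

/-! ### Levi-Civita calculus of a metric on an open set of a vector space -/

section Basic

variable {E : Type*} [NormedAddCommGroup E] [NormedSpace ℝ E]

/-- `G` is a smooth Riemannian metric on the open set `U`. -/
structure IsMetricOn (G : E → E →L[ℝ] E →L[ℝ] ℝ) (U : Set E) : Prop where
  isOpen : IsOpen U
  contDiffOn : ContDiffOn ℝ ∞ G U
  symm : ∀ y ∈ U, ∀ u v, G y u v = G y v u
  pos : ∀ y ∈ U, ∀ u, u ≠ 0 → 0 < G y u u

theorem fderiv_apply₂ {X : Type*} [NormedAddCommGroup X] [NormedSpace ℝ X]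
    {V W Z : Type*} [NormedAddCommGroup V] [NormedSpace ℝ V] [NormedAddCommGroup W]
    [NormedSpace ℝ W] [NormedAddCommGroup Z] [NormedSpace ℝ Z]
    {A : X → V →L[ℝ] W →L[ℝ] Z} {y : X} (hA : DifferentiableAt ℝ A y) (v : V) (w : W) :
    HasFDerivAt (fun z => A z v w) (((fderiv ℝ A y).flip v).flip w) y := by
  have h := (hA.hasFDerivAt.clm_apply (hasFDerivAt_const v y)).clm_apply (hasFDerivAt_const w y)
  convert h using 1
  ext u
  simp

section Congr

variable {G G' : E → E →L[ℝ] E →L[ℝ] ℝ} {y : E}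

/-- Christoffel symbols and curvature depend only on the germ of the metric. The product metric read
in a chart is known to be a coordinate warped product only on the chart target, and these
congruences bridge the gap. -/
theorem christoffelLower_congr (h : G =ᶠ[𝓝 y] G') :
    christoffelLower G y = christoffelLower G' y := by
  simp [christoffelLower, h.fderiv_eq]

theorem christoffel_congr (h : G =ᶠ[𝓝 y] G') : christoffel G y = christoffel G' y := by
  simp only [christoffel, christoffelLower_congr h, h.eq_of_nhds]

theorem christoffel_eventuallyEq (h : G =ᶠ[𝓝 y] G') : christoffel G =ᶠ[𝓝 y] christoffel G' :=
  h.eventuallyEq_nhds.mono fun _ hz => christoffel_congr hz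

theorem curvature_congr (h : G =ᶠ[𝓝 y] G') (v w : E) :
    curvature G y v w = curvature G' y v w := by
  simp only [curvature, (christoffel_eventuallyEq h).fderiv_eq, christoffel_congr h]

theorem ricci_congr (h : G =ᶠ[𝓝 y] G') : ricci G y = ricci G' y := by
  ext v w
  simp only [ricci_apply, curvature_congr h]

theorem scalar_congr [FiniteDimensional ℝ E] (h : G =ᶠ[𝓝 y] G') : scalar G y = scalar G' y := by
  simp only [scalar, ricci_congr h, h.eq_of_nhds]

end Congr

namespace IsMetricOn

variable {G : E → E →L[ℝ] E →L[ℝ] ℝ} {U : Set E} {y : E}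

theorem contDiffAt (hG : IsMetricOn G U) (hy : y ∈ U) : ContDiffAt ℝ ∞ G y :=
  hG.contDiffOn.contDiffAt (hG.isOpen.mem_nhds hy)

theorem differentiableAt (hG : IsMetricOn G U) (hy : y ∈ U) : DifferentiableAt ℝ G y :=
  (hG.contDiffAt hy).differentiableAt (by simp)

/-- Positivity on `a - b` gives nondegeneracy. The Christoffel symbols and the inverse of the warped
metric are identified below by pairing with an arbitrary vector. -/
theorem ext_inner (hG : IsMetricOn G U) (hy : y ∈ U) {a b : E} (h : ∀ w, G y a w = G y b w) :
    a = b := by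
  by_contra hab
  have h1 := hG.pos y hy (a - b) (sub_ne_zero.2 hab)
  have h2 := h (a - b)
  simp only [map_sub, _root_.sub_apply] at h1 h2
  linarith

theorem fderiv_symm (hG : IsMetricOn G U) (hy : y ∈ U) (u v w : E) :
    fderiv ℝ G y u v w = fderiv ℝ G y u w v := by
  have h1 := fderiv_apply₂ (hG.differentiableAt hy) v w
  have h2 := fderiv_apply₂ (hG.differentiableAt hy) w v
  have h3 : (fun z => G z v w) =ᶠ[𝓝 y] fun z => G z w v := by
    filter_upwards [hG.isOpen.mem_nhds hy] with z hz using hG.symm z hz v w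
  have h4 := congrArg (fun L => L u) (h1.unique (h2.congr_of_eventuallyEq h3))
  simpa using h4

theorem isInvertible [FiniteDimensional ℝ E] (hG : IsMetricOn G U) (hy : y ∈ U) :
    (G y).IsInvertible := by
  have hinj : Function.Injective (G y) := fun a b hab =>
    hG.ext_inner hy fun w => by rw [hab]
  have hdim : Module.finrank ℝ E = Module.finrank ℝ (E →L[ℝ] ℝ) := by
    rw [← (LinearMap.toContinuousLinearMap : (E →ₗ[ℝ] ℝ) ≃ₗ[ℝ] (E →L[ℝ] ℝ)).finrank_eq]
    exact (Subspace.dual_finrank_eq).symm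
  let e := LinearMap.linearEquivOfInjective (G y).toLinearMap hinj hdim
  exact ⟨e.toContinuousLinearEquiv, by ext; rfl⟩

variable [FiniteDimensional ℝ E]

theorem inner_inverse (hG : IsMetricOn G U) (hy : y ∈ U) (ξ : E →L[ℝ] ℝ) :
    G y ((G y).inverse ξ) = ξ :=
  (hG.isInvertible hy).self_apply_inverse ξ

theorem inner_christoffel (hG : IsMetricOn G U) (hy : y ∈ U) (u v w : E) :
    G y (christoffel G y u v) w =
      (1 / 2) * (fderiv ℝ G y u v w + fderiv ℝ G y v u w - fderiv ℝ G y w u v) := by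
  rw [christoffel_apply, hG.inner_inverse hy, christoffelLower_apply]

theorem christoffel_symm (hG : IsMetricOn G U) (hy : y ∈ U) (u v : E) :
    christoffel G y u v = christoffel G y v u := by
  refine hG.ext_inner hy fun w => ?_
  rw [hG.inner_christoffel hy, hG.inner_christoffel hy, hG.fderiv_symm hy w u v]
  ring

/-- Metric compatibility `∇g = 0`: in the sum of the two Koszul expressions all derivatives but one
cancel. -/
theorem fderiv_eq (hG : IsMetricOn G U) (hy : y ∈ U) (u v w : E) :
    fderiv ℝ G y u v w = G y (christoffel G y u v) w + G y (christoffel G y u w) v := by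
  rw [hG.inner_christoffel hy, hG.inner_christoffel hy]
  linarith [hG.fderiv_symm hy u v w, hG.fderiv_symm hy w u v, hG.fderiv_symm hy v u w]

theorem contDiffAt_inverse (hG : IsMetricOn G U) (hy : y ∈ U) :
    ContDiffAt ℝ ∞ (fun z => (G z).inverse) y :=
  ((hG.isInvertible hy).contDiffAt_map_inverse (n := ∞)).comp y (hG.contDiffAt hy)

theorem contDiffAt_christoffel (hG : IsMetricOn G U) (hy : y ∈ U) :
    ContDiffAt ℝ ∞ (christoffel G) y := by
  have h1 : ContDiffAt ℝ ∞ (fderiv ℝ G) y := (hG.contDiffAt hy).fderiv_right (by simp)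
  have h2 : ContDiffAt ℝ ∞ (fun z => (fderiv ℝ G z).flip) y :=
    (ContinuousLinearMap.flipₗᵢ ℝ E E (E →L[ℝ] ℝ)).contDiff.contDiffAt.comp y h1
  have h3 : ContDiffAt ℝ ∞ (christoffelLower G) y :=
    ((h1.add h2).sub (contDiffAt_const.clm_comp h2)).const_smul _
  exact ((ContinuousLinearMap.compL ℝ E (E →L[ℝ] ℝ) E).contDiff.contDiffAt.comp y
    (hG.contDiffAt_inverse hy)).clm_comp h3

theorem differentiableAt_christoffel (hG : IsMetricOn G U) (hy : y ∈ U) :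
    DifferentiableAt ℝ (christoffel G) y :=
  (hG.contDiffAt_christoffel hy).differentiableAt (by simp)

end IsMetricOn

end Basic

/-! ### Warped products in coordinates -/

section Warped

variable {E₁ : Type*} [NormedAddCommGroup E₁] [NormedSpace ℝ E₁]
  {E₂ : Type*} [NormedAddCommGroup E₂] [NormedSpace ℝ E₂]

/-- The warped product `G₁ + f² G₂` on a product of vector spaces. -/
noncomputable def warped (G₁ : E₁ → E₁ →L[ℝ] E₁ →L[ℝ] ℝ) (f : E₁ → ℝ)
    (G₂ : E₂ → E₂ →L[ℝ] E₂ →L[ℝ] ℝ) (z : E₁ × E₂) : (E₁ × E₂) →L[ℝ] (E₁ × E₂) →L[ℝ] ℝ :=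
  Riem.pullForm (G₁ z.1) (ContinuousLinearMap.fst ℝ E₁ E₂) +
    (f z.1) ^ 2 • Riem.pullForm (G₂ z.2) (ContinuousLinearMap.snd ℝ E₁ E₂)

theorem warped_apply (G₁ : E₁ → E₁ →L[ℝ] E₁ →L[ℝ] ℝ) (f : E₁ → ℝ)
    (G₂ : E₂ → E₂ →L[ℝ] E₂ →L[ℝ] ℝ) (z u v : E₁ × E₂) :
    warped G₁ f G₂ z u v = G₁ z.1 u.1 v.1 + (f z.1) ^ 2 * G₂ z.2 u.2 v.2 := rfl

/-- The logarithmic differential `df / f`. -/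
noncomputable def logDiff (f : E₁ → ℝ) (x : E₁) : E₁ →L[ℝ] ℝ := (f x)⁻¹ • fderiv ℝ f x

/-- The vector field `f ∇f`. -/
noncomputable def halfGradSq (G : E₁ → E₁ →L[ℝ] E₁ →L[ℝ] ℝ) (f : E₁ → ℝ) (x : E₁) : E₁ :=
  f x • (G x).inverse (fderiv ℝ f x)

theorem contDiff_pullForm {V W : Type*} [NormedAddCommGroup V] [NormedSpace ℝ V]
    [NormedAddCommGroup W] [NormedSpace ℝ W] (A : V →L[ℝ] W) :
    ContDiff ℝ ∞ (fun b : W →L[ℝ] W →L[ℝ] ℝ => Riem.pullForm b A) :=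
  contDiff_const.clm_comp (contDiff_id.clm_comp contDiff_const)

variable {G₁ : E₁ → E₁ →L[ℝ] E₁ →L[ℝ] ℝ} {G₂ : E₂ → E₂ →L[ℝ] E₂ →L[ℝ] ℝ} {f : E₁ → ℝ}
  {U : Set E₁} {V : Set E₂} {z : E₁ × E₂}

theorem isMetricOn_warped (h₁ : IsMetricOn G₁ U) (h₂ : IsMetricOn G₂ V)
    (hf : ContDiffOn ℝ ∞ f U) (hpos : ∀ x ∈ U, 0 < f x) :
    IsMetricOn (warped G₁ f G₂) (U ×ˢ V) where
  isOpen := h₁.isOpen.prod h₂.isOpen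
  contDiffOn := by
    have h1 : ContDiffOn ℝ ∞ (fun z : E₁ × E₂ => G₁ z.1) (U ×ˢ V) :=
      h₁.contDiffOn.comp contDiff_fst.contDiffOn fun z hz => hz.1
    have h2 : ContDiffOn ℝ ∞ (fun z : E₁ × E₂ => G₂ z.2) (U ×ˢ V) :=
      h₂.contDiffOn.comp contDiff_snd.contDiffOn fun z hz => hz.2
    have h3 : ContDiffOn ℝ ∞ (fun z : E₁ × E₂ => f z.1) (U ×ˢ V) :=
      hf.comp contDiff_fst.contDiffOn fun z hz => hz.1
    exact ((contDiff_pullForm _).comp_contDiffOn h1).add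
      ((h3.pow 2).smul ((contDiff_pullForm _).comp_contDiffOn h2))
  symm z hz u v := by
    rw [warped_apply, warped_apply, h₁.symm _ hz.1, h₂.symm _ hz.2]
  pos z hz u hu := by
    rw [warped_apply]
    have hn₁ : 0 ≤ G₁ z.1 u.1 u.1 := by
      rcases eq_or_ne u.1 0 with h | h
      · simp [h]
      · exact (h₁.pos _ hz.1 _ h).le
    have hn₂ : 0 ≤ G₂ z.2 u.2 u.2 := by
      rcases eq_or_ne u.2 0 with h | h
      · simp [h]
      · exact (h₂.pos _ hz.2 _ h).le
    have hfz : 0 < f z.1 ^ 2 := pow_pos (hpos _ hz.1) 2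
    by_cases h : u.1 = 0
    · have h' : u.2 ≠ 0 := fun h' => hu (Prod.ext h h')
      exact add_pos_of_nonneg_of_pos hn₁ (mul_pos hfz (h₂.pos _ hz.2 _ h'))
    · exact add_pos_of_pos_of_nonneg (h₁.pos _ hz.1 _ h) (mul_nonneg hfz.le hn₂)

theorem hasFDerivAt_comp_fst {W : Type*} [NormedAddCommGroup W] [NormedSpace ℝ W] {a : E₁ → W}
    {a' : E₁ →L[ℝ] W} (h : HasFDerivAt a a' z.1) :
    HasFDerivAt (fun q : E₁ × E₂ => a q.1) (a' ∘L ContinuousLinearMap.fst ℝ E₁ E₂) z :=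
  HasFDerivAt.comp z h hasFDerivAt_fst

theorem hasFDerivAt_comp_snd {W : Type*} [NormedAddCommGroup W] [NormedSpace ℝ W] {a : E₂ → W}
    {a' : E₂ →L[ℝ] W} (h : HasFDerivAt a a' z.2) :
    HasFDerivAt (fun q : E₁ × E₂ => a q.2) (a' ∘L ContinuousLinearMap.snd ℝ E₁ E₂) z :=
  HasFDerivAt.comp z h hasFDerivAt_snd

theorem fderiv_warped (hG : DifferentiableAt ℝ (warped G₁ f G₂) z)
    (h₁ : DifferentiableAt ℝ G₁ z.1) (h₂ : DifferentiableAt ℝ G₂ z.2)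
    (hf : DifferentiableAt ℝ f z.1) (u v w : E₁ × E₂) :
    fderiv ℝ (warped G₁ f G₂) z u v w = fderiv ℝ G₁ z.1 u.1 v.1 w.1 +
      2 * f z.1 * fderiv ℝ f z.1 u.1 * G₂ z.2 v.2 w.2 +
      f z.1 ^ 2 * fderiv ℝ G₂ z.2 u.2 v.2 w.2 := by
  have e1 := fderiv_apply₂ hG v w
  have e2 := (hasFDerivAt_comp_fst (E₂ := E₂) (fderiv_apply₂ h₁ v.1 w.1)).add
    (((hasFDerivAt_comp_fst (E₂ := E₂) hf.hasFDerivAt).pow 2).mul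
      (hasFDerivAt_comp_snd (E₁ := E₁) (fderiv_apply₂ h₂ v.2 w.2)))
  have e3 := congrArg (fun L => L u) (e1.unique e2)
  simp at e3
  rw [e3]
  ring

variable [FiniteDimensional ℝ E₁] [FiniteDimensional ℝ E₂]

theorem inner_halfGradSq (h₁ : IsMetricOn G₁ U) {x : E₁} (hx : x ∈ U) (w : E₁) :
    G₁ x (halfGradSq G₁ f x) w = f x * fderiv ℝ f x w := by
  rw [halfGradSq, map_smul, h₁.inner_inverse hx]
  rfl

/-- By Koszul's formula the only new terms come from differentiating `f²`, that is from `2 f df ⊗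
G₂`. Raising the base slot gives `f ∇f`; raising the fibre slot divides by `f²` and leaves `df / f`.
-/
theorem christoffel_warped (h₁ : IsMetricOn G₁ U) (h₂ : IsMetricOn G₂ V)
    (hf : ContDiffOn ℝ ∞ f U) (hpos : ∀ x ∈ U, 0 < f x) (hz : z ∈ U ×ˢ V) (u v : E₁ × E₂) :
    christoffel (warped G₁ f G₂) z u v =
      (christoffel G₁ z.1 u.1 v.1 - G₂ z.2 u.2 v.2 • halfGradSq G₁ f z.1,
        christoffel G₂ z.2 u.2 v.2 + logDiff f z.1 u.1 • v.2 + logDiff f z.1 v.1 • u.2) := by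
  have hG := isMetricOn_warped h₁ h₂ hf hpos
  have hfz := (hpos _ hz.1).ne'
  have hfd : DifferentiableAt ℝ f z.1 :=
    (hf.contDiffAt (h₁.isOpen.mem_nhds hz.1)).differentiableAt (by simp)
  have hfd' := fderiv_warped (hG.differentiableAt hz) (h₁.differentiableAt hz.1)
    (h₂.differentiableAt hz.2) hfd
  refine hG.ext_inner hz fun w => ?_
  rw [hG.inner_christoffel hz, hfd', hfd', hfd', warped_apply]
  simp only [map_sub, map_add, map_smul, _root_.sub_apply, _root_.add_apply, _root_.smul_apply,
    h₁.inner_christoffel hz.1, h₂.inner_christoffel hz.2, inner_halfGradSq h₁ hz.1, logDiff,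
    smul_eq_mul]
  rw [h₂.symm _ hz.2 u.2 w.2, h₂.symm _ hz.2 w.2 u.2]
  field_simp
  ring

end Warped

end CoordMetric
-- Curvature of a warped product in coordinates
namespace CoordMetric

section WarpedCurvature

variable {E₁ : Type*} [NormedAddCommGroup E₁] [NormedSpace ℝ E₁]
  {E₂ : Type*} [NormedAddCommGroup E₂] [NormedSpace ℝ E₂]
  {G₁ : E₁ → E₁ →L[ℝ] E₁ →L[ℝ] ℝ} {G₂ : E₂ → E₂ →L[ℝ] E₂ →L[ℝ] ℝ} {f : E₁ → ℝ}
  {U : Set E₁} {V : Set E₂} {z : E₁ × E₂}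

/-- The bilinear form `∇²f / f`, written in terms of the logarithmic differential of `f`. -/
noncomputable def logHessian (G : E₁ → E₁ →L[ℝ] E₁ →L[ℝ] ℝ) (f : E₁ → ℝ) (x : E₁) :
    E₁ →L[ℝ] E₁ →L[ℝ] ℝ :=
  fderiv ℝ (logDiff f) x - (ContinuousLinearMap.compL ℝ E₁ E₁ ℝ (logDiff f x)) ∘L christoffel G x
    + (logDiff f x).smulRight (logDiff f x)

theorem logHessian_apply (G : E₁ → E₁ →L[ℝ] E₁ →L[ℝ] ℝ) (f : E₁ → ℝ) (x u v : E₁) :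
    logHessian G f x u v = fderiv ℝ (logDiff f) x u v - logDiff f x (christoffel G x u v) +
      logDiff f x u * logDiff f x v := rfl

/-- The endomorphism `u ↦ ∇_u N - (df(u) / f) N` with `N = f ∇f`. -/
noncomputable def halfGradSqDeriv (G : E₁ → E₁ →L[ℝ] E₁ →L[ℝ] ℝ) (f : E₁ → ℝ) (x : E₁) :
    E₁ →L[ℝ] E₁ :=
  fderiv ℝ (halfGradSq G f) x + (christoffel G x).flip (halfGradSq G f x) -
    (logDiff f x).smulRight (halfGradSq G f x)

theorem halfGradSqDeriv_apply (G : E₁ → E₁ →L[ℝ] E₁ →L[ℝ] ℝ) (f : E₁ → ℝ) (x u : E₁) :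
    halfGradSqDeriv G f x u = fderiv ℝ (halfGradSq G f) x u +
      christoffel G x u (halfGradSq G f x) - logDiff f x u • halfGradSq G f x := rfl

theorem contDiffAt_logDiff {x : E₁} (hf : ContDiffAt ℝ ∞ f x) (h0 : f x ≠ 0) :
    ContDiffAt ℝ ∞ (logDiff f) x :=
  (hf.inv h0).smul (hf.fderiv_right (by simp))

/-- The form `df / f = d log f` is closed, by symmetry of the second derivative of `f`. -/
theorem fderiv_logDiff_symm {x : E₁} (hf : ContDiffAt ℝ ∞ f x) (h0 : f x ≠ 0) (u v : E₁) :
    fderiv ℝ (logDiff f) x u v = fderiv ℝ (logDiff f) x v u := by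
  have hd : DifferentiableAt ℝ (fderiv ℝ f) x :=
    (hf.fderiv_right (m := ∞) (by simp)).differentiableAt (by simp)
  have hfd := (hf.differentiableAt (by simp)).hasFDerivAt
  have h1 : HasFDerivAt (logDiff f) _ x := ((hasDerivAt_inv h0).comp_hasFDerivAt x hfd).smul hd.hasFDerivAt
  have h2 : IsSymmSndFDerivAt ℝ f x :=
    hf.isSymmSndFDerivAt (by simpa using WithTop.coe_le_coe.2 (le_top (a := (2 : ℕ∞))))
  rw [h1.fderiv]
  simp [h2.eq u v]
  ring

variable [FiniteDimensional ℝ E₁]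

theorem differentiableAt_halfGradSq (h₁ : IsMetricOn G₁ U) (hf : ContDiffOn ℝ ∞ f U) {x : E₁}
    (hx : x ∈ U) : DifferentiableAt ℝ (halfGradSq G₁ f) x := by
  have hfx := hf.contDiffAt (h₁.isOpen.mem_nhds hx)
  have h : ContDiffAt ℝ ∞ (halfGradSq G₁ f) x :=
    hfx.smul ((h₁.contDiffAt_inverse hx).clm_apply (hfx.fderiv_right (by simp)))
  exact h.differentiableAt (by simp)

variable [FiniteDimensional ℝ E₂]

theorem fderiv_christoffel_warped (h₁ : IsMetricOn G₁ U) (h₂ : IsMetricOn G₂ V)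
    (hf : ContDiffOn ℝ ∞ f U) (hpos : ∀ x ∈ U, 0 < f x) (hz : z ∈ U ×ˢ V) (u v w : E₁ × E₂) :
    fderiv ℝ (christoffel (warped G₁ f G₂)) z u v w =
      (fderiv ℝ (christoffel G₁) z.1 u.1 v.1 w.1
          - fderiv ℝ G₂ z.2 u.2 v.2 w.2 • halfGradSq G₁ f z.1
          - G₂ z.2 v.2 w.2 • fderiv ℝ (halfGradSq G₁ f) z.1 u.1,
        fderiv ℝ (christoffel G₂) z.2 u.2 v.2 w.2 + fderiv ℝ (logDiff f) z.1 u.1 v.1 • w.2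
          + fderiv ℝ (logDiff f) z.1 u.1 w.1 • v.2) := by
  have hG := isMetricOn_warped h₁ h₂ hf hpos
  have hfx := hf.contDiffAt (h₁.isOpen.mem_nhds hz.1)
  have hφ : DifferentiableAt ℝ (logDiff f) z.1 :=
    (contDiffAt_logDiff hfx (hpos _ hz.1).ne').differentiableAt (by simp)
  have hφ' (a : E₁) : HasFDerivAt (fun x => logDiff f x a) ((fderiv ℝ (logDiff f) z.1).flip a)
      z.1 :=
     (hφ.hasFDerivAt.clm_apply (hasFDerivAt_const a z.1)).congr_fderiv (by ext; simp)
  have e1 := fderiv_apply₂ (hG.differentiableAt_christoffel hz) v w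
  have e2 := (hasFDerivAt_comp_fst (E₂ := E₂)
      (fderiv_apply₂ (h₁.differentiableAt_christoffel hz.1) v.1 w.1)).sub
    ((hasFDerivAt_comp_snd (E₁ := E₁) (fderiv_apply₂ (h₂.differentiableAt hz.2) v.2 w.2)).smul
      (hasFDerivAt_comp_fst (E₂ := E₂) (differentiableAt_halfGradSq h₁ hf hz.1).hasFDerivAt))
  have e3 := ((hasFDerivAt_comp_snd (E₁ := E₁)
      (fderiv_apply₂ (h₂.differentiableAt_christoffel hz.2) v.2 w.2)).add
    ((hasFDerivAt_comp_fst (E₂ := E₂) (hφ' v.1)).smul (hasFDerivAt_const w.2 z))).add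
    ((hasFDerivAt_comp_fst (E₂ := E₂) (hφ' w.1)).smul (hasFDerivAt_const v.2 z))
  have e4 : (fun q => christoffel (warped G₁ f G₂) q v w) =ᶠ[𝓝 z] fun q =>
      (christoffel G₁ q.1 v.1 w.1 - G₂ q.2 v.2 w.2 • halfGradSq G₁ f q.1,
        christoffel G₂ q.2 v.2 w.2 + logDiff f q.1 v.1 • w.2 + logDiff f q.1 w.1 • v.2) := by
    filter_upwards [hG.isOpen.mem_nhds hz] with q hq using christoffel_warped h₁ h₂ hf hpos hq v w
  have e5 := congrArg (fun L => L u) (e1.unique ((e2.prodMk e3).congr_of_eventuallyEq e4))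
  simp at e5
  rw [e5]
  ext
  · simp; abel
  · simp

/-- Derivatives of the fibre metric cancel against fibre Christoffel terms by metric compatibility,
and the antisymmetric part of the derivative of `df / f` vanishes since this form is closed. Here
`halfGradSqDeriv` is `u ↦ f ∇_u ∇f`, and `logDiff` evaluated on `halfGradSq` is `|∇f|²`. -/
theorem curvature_warped (h₁ : IsMetricOn G₁ U) (h₂ : IsMetricOn G₂ V)
    (hf : ContDiffOn ℝ ∞ f U) (hpos : ∀ x ∈ U, 0 < f x) (hz : z ∈ U ×ˢ V) (u v w : E₁ × E₂) :
    curvature (warped G₁ f G₂) z v w u =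
      (curvature G₁ z.1 v.1 w.1 u.1 - G₂ z.2 v.2 w.2 • halfGradSqDeriv G₁ f z.1 u.1
          + G₂ z.2 u.2 w.2 • halfGradSqDeriv G₁ f z.1 v.1,
        curvature G₂ z.2 v.2 w.2 u.2 + logHessian G₁ f z.1 u.1 w.1 • v.2
          - logHessian G₁ f z.1 v.1 w.1 • u.2
          + logDiff f z.1 (halfGradSq G₁ f z.1) • (G₂ z.2 u.2 w.2 • v.2 - G₂ z.2 v.2 w.2 • u.2))
      := by
  have hfx := hf.contDiffAt (h₁.isOpen.mem_nhds hz.1)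
  have hsymm := fderiv_logDiff_symm hfx (hpos _ hz.1).ne' u.1 v.1
  rw [curvature_apply, fderiv_christoffel_warped h₁ h₂ hf hpos hz,
    fderiv_christoffel_warped h₁ h₂ hf hpos hz]
  simp only [christoffel_warped h₁ h₂ hf hpos hz]
  have c1 := h₂.fderiv_eq hz.2 u.2 v.2 w.2
  have c2 := h₂.fderiv_eq hz.2 v.2 u.2 w.2
  rw [h₂.christoffel_symm hz.2 v.2 u.2] at c2
  have s1 := h₂.symm _ hz.2 u.2 (christoffel G₂ z.2 v.2 w.2)
  have s2 := h₂.symm _ hz.2 v.2 (christoffel G₂ z.2 u.2 w.2)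
  have s3 := h₂.symm _ hz.2 u.2 v.2
  ext
  · simp only [Prod.fst_add, Prod.fst_sub, c1, c2, curvature_apply, halfGradSqDeriv_apply,
      map_add, map_sub, map_smul, s1, s2, s3, smul_eq_mul]
    module
  · simp only [Prod.snd_add, Prod.snd_sub, curvature_apply, logHessian_apply, hsymm,
      map_add, map_sub, map_smul, smul_eq_mul, h₂.christoffel_symm hz.2 v.2 u.2]
    module

/-- Factoring `T` through the two summands and using cyclicity of the trace leaves only the diagonal
blocks. -/
theorem trace_prod (T : (E₁ × E₂) →ₗ[ℝ] (E₁ × E₂)) :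
    LinearMap.trace ℝ (E₁ × E₂) T =
      LinearMap.trace ℝ E₁ (LinearMap.fst ℝ E₁ E₂ ∘ₗ T ∘ₗ LinearMap.inl ℝ E₁ E₂) +
      LinearMap.trace ℝ E₂ (LinearMap.snd ℝ E₁ E₂ ∘ₗ T ∘ₗ LinearMap.inr ℝ E₁ E₂) := by
  have h : T = LinearMap.inl ℝ E₁ E₂ ∘ₗ (LinearMap.fst ℝ E₁ E₂ ∘ₗ T) +
      LinearMap.inr ℝ E₁ E₂ ∘ₗ (LinearMap.snd ℝ E₁ E₂ ∘ₗ T) := by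
    refine LinearMap.ext fun u => ?_
    ext <;> simp
  conv_lhs => rw [h]
  rw [map_add, LinearMap.trace_comp_comm', LinearMap.trace_comp_comm' _ (LinearMap.inr ℝ E₁ E₂)]
  rfl

/-- The coefficient of `g_F` in the Ricci tensor of a warped product, with fibre dimension `m`. -/
noncomputable def warpedRicciCoeff (G : E₁ → E₁ →L[ℝ] E₁ →L[ℝ] ℝ) (f : E₁ → ℝ) (m : ℝ)
    (x : E₁) : ℝ :=
  (1 - m) * logDiff f x (halfGradSq G f x) -
    LinearMap.trace ℝ E₁ (halfGradSqDeriv G f x).toLinearMap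

/-- The curvature endomorphism is traced block by block. With fibre dimension `m`, the coefficient
of the fibre metric is the classical `-(f Δf + (m - 1) |∇f|²)`; only its dependence on the base
point alone matters later. -/
theorem ricci_warped (h₁ : IsMetricOn G₁ U) (h₂ : IsMetricOn G₂ V)
    (hf : ContDiffOn ℝ ∞ f U) (hpos : ∀ x ∈ U, 0 < f x) (hz : z ∈ U ×ˢ V) (v w : E₁ × E₂) :
    ricci (warped G₁ f G₂) z v w =
      ricci G₁ z.1 v.1 w.1 - Module.finrank ℝ E₂ * logHessian G₁ f z.1 v.1 w.1 +
        (ricci G₂ z.2 v.2 w.2 +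
          warpedRicciCoeff G₁ f (Module.finrank ℝ E₂) z.1 * G₂ z.2 v.2 w.2) := by
  have e1 : LinearMap.fst ℝ E₁ E₂ ∘ₗ (curvature (warped G₁ f G₂) z v w).toLinearMap ∘ₗ
      LinearMap.inl ℝ E₁ E₂ = (curvature G₁ z.1 v.1 w.1).toLinearMap -
        G₂ z.2 v.2 w.2 • (halfGradSqDeriv G₁ f z.1).toLinearMap := by
    ext u
    simp [curvature_warped h₁ h₂ hf hpos hz]
  -- The rank-one map `u ↦ G₂(u, w) v` has trace `G₂(v, w)`, so the last bracket has trace `(1 - m)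
  -- G₂(v, w)`.
  have e2 : LinearMap.snd ℝ E₁ E₂ ∘ₗ (curvature (warped G₁ f G₂) z v w).toLinearMap ∘ₗ
      LinearMap.inr ℝ E₁ E₂ = (curvature G₂ z.2 v.2 w.2).toLinearMap -
        logHessian G₁ f z.1 v.1 w.1 • LinearMap.id +
        logDiff f z.1 (halfGradSq G₁ f z.1) •
          (((G₂ z.2).flip w.2).toLinearMap.smulRight v.2 - G₂ z.2 v.2 w.2 • LinearMap.id) := by
    ext u
    simp [curvature_warped h₁ h₂ hf hpos hz]
  rw [ricci_apply, trace_prod, e1, e2]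
  simp only [map_sub, map_add, map_smul, LinearMap.trace_smulRight, LinearMap.trace_id,
    smul_eq_mul, ricci_apply, warpedRicciCoeff]
  simp
  ring

/-- The part of `f² R` coming from the base and the warping function, for a warped product with
fibre dimension `m` and scalar curvature `R`. -/
noncomputable def warpedScalarCoeff (G : E₁ → E₁ →L[ℝ] E₁ →L[ℝ] ℝ) (f : E₁ → ℝ) (m : ℝ)
    (x : E₁) : ℝ :=
  f x ^ 2 * (scalar G x -
      m * LinearMap.trace ℝ E₁ ((G x).inverse ∘L logHessian G f x).toLinearMap) +
    m * warpedRicciCoeff G f m x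

/-- The inverse metric is block diagonal with a factor `f⁻²` on the fibre block. The identity is
multiplied by `f²` so that the fibre scalar curvature appears with coefficient one, as in `ρ R_F + λ
f²`. -/
theorem scalar_warped (h₁ : IsMetricOn G₁ U) (h₂ : IsMetricOn G₂ V)
    (hf : ContDiffOn ℝ ∞ f U) (hpos : ∀ x ∈ U, 0 < f x) (hz : z ∈ U ×ˢ V) :
    f z.1 ^ 2 * scalar (warped G₁ f G₂) z =
      scalar G₂ z.2 + warpedScalarCoeff G₁ f (Module.finrank ℝ E₂) z.1 := by
  have hG := isMetricOn_warped h₁ h₂ hf hpos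
  have hfz := (hpos _ hz.1).ne'
  have hinv (ξ : (E₁ × E₂) →L[ℝ] ℝ) : (warped G₁ f G₂ z).inverse ξ =
      ((G₁ z.1).inverse (ξ ∘L ContinuousLinearMap.inl ℝ E₁ E₂),
        (f z.1 ^ 2)⁻¹ • (G₂ z.2).inverse (ξ ∘L ContinuousLinearMap.inr ℝ E₁ E₂)) := by
    refine hG.ext_inner hz fun w => ?_
    rw [hG.inner_inverse hz, warped_apply]
    simp only [map_smul, h₁.inner_inverse hz.1, h₂.inner_inverse hz.2, _root_.smul_apply,
      smul_eq_mul]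
    rw [mul_inv_cancel_left₀ (pow_ne_zero 2 hfz)]
    simp [← map_add]
  set m : ℝ := (Module.finrank ℝ E₂ : ℝ)
  have e1 : LinearMap.fst ℝ E₁ E₂ ∘ₗ ((warped G₁ f G₂ z).inverse.toLinearMap ∘ₗ
      (LinearMap.toContinuousLinearMap : ((E₁ × E₂) →ₗ[ℝ] ℝ) ≃ₗ[ℝ] _).toLinearMap ∘ₗ
        ricci (warped G₁ f G₂) z) ∘ₗ LinearMap.inl ℝ E₁ E₂ =
      (G₁ z.1).inverse.toLinearMap ∘ₗ
        (LinearMap.toContinuousLinearMap : (E₁ →ₗ[ℝ] ℝ) ≃ₗ[ℝ] _).toLinearMap ∘ₗ ricci G₁ z.1 -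
      m • ((G₁ z.1).inverse ∘L logHessian G₁ f z.1).toLinearMap := by
    ext u
    simp only [LinearMap.comp_apply, LinearMap.fst_apply, ContinuousLinearMap.coe_coe, hinv,
      LinearMap.sub_apply, LinearMap.smul_apply, ContinuousLinearMap.coe_comp,
      Function.comp_apply]
    rw [← map_smul, ← map_sub]
    congr 1
    ext v
    simp [ricci_warped h₁ h₂ hf hpos hz, m]
  have e2 : LinearMap.snd ℝ E₁ E₂ ∘ₗ ((warped G₁ f G₂ z).inverse.toLinearMap ∘ₗ
      (LinearMap.toContinuousLinearMap : ((E₁ × E₂) →ₗ[ℝ] ℝ) ≃ₗ[ℝ] _).toLinearMap ∘ₗ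
        ricci (warped G₁ f G₂) z) ∘ₗ LinearMap.inr ℝ E₁ E₂ =
      (f z.1 ^ 2)⁻¹ • ((G₂ z.2).inverse.toLinearMap ∘ₗ
        (LinearMap.toContinuousLinearMap : (E₂ →ₗ[ℝ] ℝ) ≃ₗ[ℝ] _).toLinearMap ∘ₗ ricci G₂ z.2 +
      warpedRicciCoeff G₁ f m z.1 • LinearMap.id) := by
    ext u
    simp only [LinearMap.comp_apply, LinearMap.snd_apply, ContinuousLinearMap.coe_coe, hinv,
      LinearMap.add_apply, LinearMap.smul_apply, LinearMap.id_apply]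
    congr 1
    -- Writing `u` as a raised covector puts the identity term under the inverse metric, so both
    -- sides can be compared as covectors.
    have hu : u = (G₂ z.2).inverse (G₂ z.2 u) :=
      ((h₂.isInvertible hz.2).inverse_apply_self u).symm
    conv_rhs => enter [2, 2]; rw [hu]
    rw [← map_smul, ← map_add]
    congr 1
    ext v
    simp [ricci_warped h₁ h₂ hf hpos hz, m]
  rw [scalar, trace_prod, e1, e2]
  simp only [map_sub, map_add, map_smul, LinearMap.trace_id, smul_eq_mul, warpedScalarCoeff,
    scalar, m]
  field_simp
  ring

end WarpedCurvature

end CoordMetric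
-- Riemannian metrics and warped products read in charts
namespace Riem

section Charts

variable {E : Type*} [NormedAddCommGroup E] [NormedSpace ℝ E]
  {H : Type*} [TopologicalSpace H] {I : ModelWithCorners ℝ E H} [I.Boundaryless]
  {M : Type*} [TopologicalSpace M] [ChartedSpace H M] [IsManifold I ∞ M]

theorem contMDiffAt_extChartAt_symm {p : M} {y : E} (hy : y ∈ (extChartAt I p).target) :
    ContMDiffAt 𝓘(ℝ, E) I ∞ (extChartAt I p).symm y :=
  (contMDiffOn_extChartAt_symm p).contMDiffAt ((isOpen_extChartAt_target p).mem_nhds hy)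

theorem mdifferentiableAt_extChartAt_symm {p : M} {y : E} (hy : y ∈ (extChartAt I p).target) :
    MDifferentiableAt 𝓘(ℝ, E) I (extChartAt I p).symm y :=
  (contMDiffAt_extChartAt_symm hy).mdifferentiableAt (by simp)

theorem isInvertible_mfderiv_extChartAt_symm {p : M} {y : E}
    (hy : y ∈ (extChartAt I p).target) :
    (mfderiv 𝓘(ℝ, E) I (extChartAt I p).symm y).IsInvertible := by
  have : IsManifold I 1 M := IsManifold.of_le (n := ∞) (by simp)
  have h := isInvertible_mfderivWithin_extChartAt_symm (I := I) hy
  rwa [I.range_eq_univ, mfderivWithin_univ] at h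

-- The tangent space at `p` is modelled on `E` through the preferred chart at `p`, so the derivative
-- of that chart at `p` is the identity. Tangent vectors can then be used directly as coordinate
-- vectors.
omit [I.Boundaryless] in
theorem components_eq_id (p : M) : components (I := I) p = ContinuousLinearMap.id ℝ E := by
  have : IsManifold I 1 M := IsManifold.of_le (n := ∞) (by simp)
  exact mfderiv_extChartAt_self

omit [I.Boundaryless] in
theorem inChart_apply (g : Metric I M) (p : M) (y u v : E) :
    inChart g p y u v = g.inner ((extChartAt I p).symm y)
      (mfderiv 𝓘(ℝ, E) I (extChartAt I p).symm y u)
      (mfderiv 𝓘(ℝ, E) I (extChartAt I p).symm y v) := rfl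

theorem contDiffAt_inChart (g : Metric I M) {p : M} {y : E}
    (hy : y ∈ (extChartAt I p).target) : ContDiffAt ℝ ∞ (inChart g p) y := by
  set φ := (extChartAt I p).symm
  have hφ : ContMDiffAt 𝓘(ℝ, E) I ∞ φ y := contMDiffAt_extChartAt_symm hy
  have hD := hφ.mfderiv_const (x₀ := y) (m := ∞) (by simp)
  have hG : ContMDiffAt 𝓘(ℝ, E) 𝓘(ℝ, E →L[ℝ] E →L[ℝ] ℝ) ∞
      (fun x => ContinuousLinearMap.inCoordinates
      E (TangentSpace I) (E →L[ℝ] ℝ) (fun b : M => TangentSpace I b →L[ℝ] ℝ)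
      (φ y) (φ x) (φ y) (φ x) (g.inner (φ x))) y :=
    ((contMDiffAt_hom_bundle _).1 ((g.contMDiff (φ y)).comp y hφ)).2
  have key := hG.clm_comp hD
  have key2 := (hD.clm_precomp (F₃ := ℝ)).clm_comp key
  rw [← contMDiffAt_iff_contDiffAt]
  refine key2.congr_of_eventuallyEq ?_
  have h2 := hφ.continuousAt.preimage_mem_nhds
    ((trivializationAt E (TangentSpace I) (φ y)).open_baseSet.mem_nhds
    (FiberBundle.mem_baseSet_trivializationAt' (φ y)))
  filter_upwards [h2] with x hx'
  have hx'' : φ x ∈ (trivializationAt E (TangentSpace I) (φ y)).baseSet := hx'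
  ext u v
  simp only [ContinuousLinearMap.comp_apply, ContinuousLinearMap.precomp_apply]
  rw [inCoordinates_apply_eq₂ hx'' hx'' (by simp)]
  -- The trivialization on the vector space side is the identity, and the one on the manifold side
  -- cancels against its inverse.
  have hlin : ∀ w : E, (trivializationAt E (TangentSpace I) (φ y)).symm (φ x)
      ((inTangentCoordinates 𝓘(ℝ, E) I id φ (mfderiv 𝓘(ℝ, E) I φ) y x) w) =
      mfderiv 𝓘(ℝ, E) I φ x w := by
    intro w
    unfold inTangentCoordinates
    have hx : x ∈ (trivializationAt E (TangentSpace 𝓘(ℝ, E)) y).baseSet := by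
      rw [TangentBundle.trivializationAt_baseSet, chartAt_self_eq]
      exact Set.mem_univ x
    have hxw : (trivializationAt E (TangentSpace 𝓘(ℝ, E)) y).symm x w = w := by
      rw [← Bundle.Trivialization.symmL_apply (R := ℝ) _ hx,
        TangentBundle.symmL_model_space]
      rfl
    rw [ContinuousLinearMap.inCoordinates_eq (x₀ := id y) (x := id x) hx hx'']
    simp [Bundle.Trivialization.symm_apply_apply_mk _ hx'']
    exact congrArg (mfderiv 𝓘(ℝ, E) I φ x) hxw
  rw [hlin, hlin]
  change g.inner (φ x) (mfderiv 𝓘(ℝ, E) I φ x u) (mfderiv 𝓘(ℝ, E) I φ x v) = _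
  simp

theorem isMetricOn_inChart (g : Metric I M) (p : M) :
    CoordMetric.IsMetricOn (inChart g p) (extChartAt I p).target where
  isOpen := isOpen_extChartAt_target p
  contDiffOn _ hy := (contDiffAt_inChart g hy).contDiffWithinAt
  symm y _ u v := g.symm _ _ _
  pos y hy u hu := by
    refine g.pos _ _ fun h => hu ?_
    exact (isInvertible_mfderiv_extChartAt_symm hy).injective (h.trans (map_zero _).symm)

/-- Needed at points `q` other than the centre of the chart: differentiating the fibre energy along
a curve requires one fixed chart for all nearby times. -/
theorem inChart_mfderiv (g : Metric I M) {p q : M} (hq : q ∈ (extChartAt I p).source)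
    (u v : TangentSpace I q) :
    inChart g p (extChartAt I p q) (mfderiv I 𝓘(ℝ, E) (extChartAt I p) q u)
      (mfderiv I 𝓘(ℝ, E) (extChartAt I p) q v) = g.inner q u v := by
  have : IsManifold I 1 M := IsManifold.of_le (n := ∞) (by simp)
  have h := mfderivWithin_extChartAt_symm_comp_mfderiv_extChartAt' (I := I) hq
  rw [I.range_eq_univ, mfderivWithin_univ] at h
  have h' (w : TangentSpace I q) : mfderiv 𝓘(ℝ, E) I (extChartAt I p).symm (extChartAt I p q)
      (mfderiv I 𝓘(ℝ, E) (extChartAt I p) q w) = w := congrArg (fun L => L w) h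
  have h1 : inChart g p (extChartAt I p q) (mfderiv I 𝓘(ℝ, E) (extChartAt I p) q u)
      (mfderiv I 𝓘(ℝ, E) (extChartAt I p) q v) =
      g.inner ((extChartAt I p).symm (extChartAt I p q)) u v := by
    exact (inChart_apply g p _ _ _).trans (congrArg₂
      (fun a b => g.inner ((extChartAt I p).symm (extChartAt I p q)) a b) (h' u) (h' v))
  rw [h1, (extChartAt I p).left_inv hq]

omit [I.Boundaryless] in
theorem ricci_eq_coord (g : Metric I M) (p : M) (u v : TangentSpace I p) :
    ricci g p u v = CoordMetric.ricci (inChart g p) (extChartAt I p p) u v := by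
  rw [ricci, components_eq_id]; rfl

omit [I.Boundaryless] in
theorem hessian_eq_coord (g : Metric I M) (h : M → ℝ) (p : M) (u v : TangentSpace I p) :
    hessian g h p u v = CoordMetric.hessian (inChart g p) (h ∘ (extChartAt I p).symm)
      (extChartAt I p p) u v := by
  rw [hessian, components_eq_id]; rfl

omit [IsManifold I ∞ M] in
theorem differential_eq_coord {h : M → ℝ} {p : M} (hh : MDifferentiableAt I 𝓘(ℝ, ℝ) h p)
    (u : TangentSpace I p) :
    differential I h p u = fderiv ℝ (h ∘ (extChartAt I p).symm) (extChartAt I p p) u := by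
  have e : fderivWithin ℝ (writtenInExtChartAt I 𝓘(ℝ, ℝ) p h) (Set.range I) (extChartAt I p p) =
      fderiv ℝ (h ∘ (extChartAt I p).symm) (extChartAt I p p) := by
    rw [I.range_eq_univ, fderivWithin_univ]
    simp only [writtenInExtChartAt, extChartAt_model_space_eq_id]
    rfl
  exact congrArg (fun L => L u) (hh.mfderiv.trans e)

omit [I.Boundaryless] in
theorem contDiffOn_comp_extChartAt_symm {h : M → ℝ} (hh : ContMDiff I 𝓘(ℝ, ℝ) ∞ h) (p : M) :
    ContDiffOn ℝ ∞ (h ∘ (extChartAt I p).symm) (extChartAt I p).target :=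
  contMDiffOn_iff_contDiffOn.1 (hh.comp_contMDiffOn (contMDiffOn_extChartAt_symm p))

end Charts

section Warped

variable {E₁ : Type*} [NormedAddCommGroup E₁] [NormedSpace ℝ E₁]
  {H₁ : Type*} [TopologicalSpace H₁] {I₁ : ModelWithCorners ℝ E₁ H₁} [I₁.Boundaryless]
  {B : Type*} [TopologicalSpace B] [ChartedSpace H₁ B] [IsManifold I₁ ∞ B]
  {E₂ : Type*} [NormedAddCommGroup E₂] [NormedSpace ℝ E₂]
  {H₂ : Type*} [TopologicalSpace H₂] {I₂ : ModelWithCorners ℝ E₂ H₂} [I₂.Boundaryless]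
  {F : Type*} [TopologicalSpace F] [ChartedSpace H₂ F] [IsManifold I₂ ∞ F]

omit [I₁.Boundaryless] [IsManifold I₁ ∞ B] [I₂.Boundaryless] [IsManifold I₂ ∞ F] in
theorem extChartAt_prod_symm (x : B) (y : F) :
    ((extChartAt (I₁.prod I₂) (x, y)).symm : E₁ × E₂ → B × F) =
      Prod.map (extChartAt I₁ x).symm (extChartAt I₂ y).symm := by
  rw [extChartAt_prod]; rfl

omit [I₁.Boundaryless] [IsManifold I₁ ∞ B] [I₂.Boundaryless] [IsManifold I₂ ∞ F] in
theorem extChartAt_prod_target (x : B) (y : F) :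
    (extChartAt (I₁.prod I₂) (x, y)).target =
      (extChartAt I₁ x).target ×ˢ (extChartAt I₂ y).target := by
  rw [extChartAt_prod]; rfl

omit [I₁.Boundaryless] [IsManifold I₁ ∞ B] [I₂.Boundaryless] [IsManifold I₂ ∞ F] in
theorem extChartAt_prod_apply (x : B) (y : F) (q : B × F) :
    extChartAt (I₁.prod I₂) (x, y) q = (extChartAt I₁ x q.1, extChartAt I₂ y q.2) := by
  rw [extChartAt_prod]; rfl

theorem mfderiv_fst_extChartAt_symm {x : B} {y : F} {z : E₁ × E₂}
    (hz : z ∈ (extChartAt I₁ x).target ×ˢ (extChartAt I₂ y).target) (u : E₁ × E₂) :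
    mfderiv (I₁.prod I₂) I₁ Prod.fst ((extChartAt (I₁.prod I₂) (x, y)).symm z)
      (mfderiv 𝓘(ℝ, E₁ × E₂) (I₁.prod I₂) (extChartAt (I₁.prod I₂) (x, y)).symm z u) =
    mfderiv 𝓘(ℝ, E₁) I₁ (extChartAt I₁ x).symm z.1 u.1 := by
  have hz' : z ∈ (extChartAt (I₁.prod I₂) (x, y)).target := by rwa [extChartAt_prod_target]
  have e1 := mfderiv_comp z (g := (Prod.fst : B × F → B)) (I'' := I₁) mdifferentiableAt_fst
    (mdifferentiableAt_extChartAt_symm hz')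
  have e2 := mfderiv_comp z (I := 𝓘(ℝ, E₁ × E₂)) (f := (Prod.fst : E₁ × E₂ → E₁))
    (mdifferentiableAt_extChartAt_symm hz.1) differentiableAt_fst.mdifferentiableAt
  have e3 : (Prod.fst : B × F → B) ∘ (extChartAt (I₁.prod I₂) (x, y)).symm =
      (extChartAt I₁ x).symm ∘ Prod.fst := by
    rw [extChartAt_prod_symm]; rfl
  have e4 : mfderiv 𝓘(ℝ, E₁ × E₂) 𝓘(ℝ, E₁) (Prod.fst : E₁ × E₂ → E₁) z =
      ContinuousLinearMap.fst ℝ E₁ E₂ := by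
    rw [mfderiv_eq_fderiv, fderiv_fst]
  rw [e4] at e2
  have e5 := mfderiv_congr (I := 𝓘(ℝ, E₁ × E₂)) (I' := I₁) (x := z) e3
  exact (congrArg (fun L => L u) e1).symm.trans
    ((congrArg (fun L : E₁ × E₂ →L[ℝ] E₁ => L u) e5).trans (congrArg (fun L => L u) e2))

theorem mfderiv_snd_extChartAt_symm {x : B} {y : F} {z : E₁ × E₂}
    (hz : z ∈ (extChartAt I₁ x).target ×ˢ (extChartAt I₂ y).target) (u : E₁ × E₂) :
    mfderiv (I₁.prod I₂) I₂ Prod.snd ((extChartAt (I₁.prod I₂) (x, y)).symm z)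
      (mfderiv 𝓘(ℝ, E₁ × E₂) (I₁.prod I₂) (extChartAt (I₁.prod I₂) (x, y)).symm z u) =
    mfderiv 𝓘(ℝ, E₂) I₂ (extChartAt I₂ y).symm z.2 u.2 := by
  have hz' : z ∈ (extChartAt (I₁.prod I₂) (x, y)).target := by rwa [extChartAt_prod_target]
  have e1 := mfderiv_comp z (g := (Prod.snd : B × F → F)) (I'' := I₂) mdifferentiableAt_snd
    (mdifferentiableAt_extChartAt_symm hz')
  have e2 := mfderiv_comp z (I := 𝓘(ℝ, E₁ × E₂)) (f := (Prod.snd : E₁ × E₂ → E₂))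
    (mdifferentiableAt_extChartAt_symm hz.2) differentiableAt_snd.mdifferentiableAt
  have e3 : (Prod.snd : B × F → F) ∘ (extChartAt (I₁.prod I₂) (x, y)).symm =
      (extChartAt I₂ y).symm ∘ Prod.snd := by
    rw [extChartAt_prod_symm]; rfl
  have e4 : mfderiv 𝓘(ℝ, E₁ × E₂) 𝓘(ℝ, E₂) (Prod.snd : E₁ × E₂ → E₂) z =
      ContinuousLinearMap.snd ℝ E₁ E₂ := by
    rw [mfderiv_eq_fderiv, fderiv_snd]
  rw [e4] at e2
  have e5 := mfderiv_congr (I := 𝓘(ℝ, E₁ × E₂)) (I' := I₂) (x := z) e3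
  exact (congrArg (fun L => L u) e1).symm.trans
    ((congrArg (fun L : E₁ × E₂ →L[ℝ] E₂ => L u) e5).trans (congrArg (fun L => L u) e2))

theorem inChart_warpedMetric (gB : Metric I₁ B) (f : B → ℝ) (hf : ContMDiff I₁ 𝓘(ℝ, ℝ) ∞ f)
    (hpos : ∀ x, 0 < f x) (gF : Metric I₂ F) (x : B) (y : F) {z : E₁ × E₂}
    (hz : z ∈ (extChartAt I₁ x).target ×ˢ (extChartAt I₂ y).target) :
    inChart (warpedMetric gB f hf hpos gF) (x, y) z =
      CoordMetric.warped (inChart gB x) (f ∘ (extChartAt I₁ x).symm) (inChart gF y) z := by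
  have hp : (extChartAt (I₁.prod I₂) (x, y)).symm z =
      ((extChartAt I₁ x).symm z.1, (extChartAt I₂ y).symm z.2) := by
    rw [extChartAt_prod_symm]; rfl
  -- The inner products live in tangent spaces at equal but not syntactically identical points;
  -- substituting the equality transports the whole expression.
  have key : ∀ (q q' : B × F), q = q' → ∀ a a' b b',
      gB.inner q.1 a a' + f q.1 ^ 2 * gF.inner q.2 b b' =
        gB.inner q'.1 a a' + f q'.1 ^ 2 * gF.inner q'.2 b b' := by
    rintro q _ rfl a a' b b'; rfl
  refine ContinuousLinearMap.ext fun u => ContinuousLinearMap.ext fun v => ?_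
  rw [CoordMetric.warped_apply, inChart_apply, inChart_apply, inChart_apply]
  refine (warpedForm_apply gB f gF _ _ _).trans ?_
  rw [mfderiv_fst_extChartAt_symm hz, mfderiv_fst_extChartAt_symm hz,
    mfderiv_snd_extChartAt_symm hz, mfderiv_snd_extChartAt_symm hz]
  exact key _ _ hp _ _ _ _

end Warped

end Riem
-- Functions with zero differential, slices, and the structure equation on a warped product
namespace Riem

section Constancy

variable {E : Type*} [NormedAddCommGroup E] [NormedSpace ℝ E]
  {H : Type*} [TopologicalSpace H] {I : ModelWithCorners ℝ E H} [I.Boundaryless]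
  {M : Type*} [TopologicalSpace M] [ChartedSpace H M] [IsManifold I ∞ M]

/-- On a connected manifold, a function with zero differential is constant. -/
theorem eq_of_hasMFDerivAt_zero [ConnectedSpace M] {k : M → ℝ}
    (hk : ∀ p, HasMFDerivAt I 𝓘(ℝ, ℝ) k p 0) (p q : M) : k p = k q := by
  refine IsLocallyConstant.apply_eq_of_preconnectedSpace
    ((IsLocallyConstant.iff_eventually_eq k).2 fun p => ?_) p q
  have hopen := isOpen_extChartAt_target (I := I) p
  obtain ⟨r, hr, hball⟩ := Metric.isOpen_iff.1 hopen _ (mem_extChartAt_target (I := I) p)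
  have hd : ∀ a ∈ Metric.ball (extChartAt I p p) r,
      HasFDerivAt (k ∘ (extChartAt I p).symm) (0 : E →L[ℝ] ℝ) a := by
    intro a ha
    have h1 := (hk ((extChartAt I p).symm a)).comp a
      (mdifferentiableAt_extChartAt_symm (hball ha)).hasMFDerivAt
    have h2 := h1.hasFDerivAt
    exact h2.congr_fderiv (by ext; rfl)
  have hconst : ∀ a ∈ Metric.ball (extChartAt I p p) r,
      (k ∘ (extChartAt I p).symm) a = (k ∘ (extChartAt I p).symm) (extChartAt I p p) :=
    fun a ha => Metric.isOpen_ball.is_const_of_fderiv_eq_zero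
      (convex_ball _ _).isPreconnected (fun b hb => (hd b hb).differentiableAt.differentiableWithinAt)
      (fun b hb => (hd b hb).fderiv) ha (Metric.mem_ball_self hr)
  filter_upwards [extChartAt_source_mem_nhds (I := I) p,
    (continuousAt_extChartAt (I := I) p).preimage_mem_nhds (Metric.ball_mem_nhds _ hr)] with q hq hq'
  have := hconst _ hq'
  rwa [Function.comp_apply, Function.comp_apply, (extChartAt I p).left_inv hq,
    extChartAt_to_inv] at this

theorem exists_differential_ne_zero [ConnectedSpace M] {k : M → ℝ}
    (hk : ContMDiff I 𝓘(ℝ, ℝ) ∞ k) (hne : ¬ ∃ c : ℝ, ∀ p, k p = c) :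
    ∃ (p : M) (u : TangentSpace I p), differential I k p u ≠ 0 := by
  by_contra! h
  obtain ⟨p⟩ : Nonempty M := inferInstance
  refine hne ⟨k p, fun q => eq_of_hasMFDerivAt_zero (I := I) (fun x => ?_) q p⟩
  have h1 := ((hk x).mdifferentiableAt (by simp)).hasMFDerivAt
  have h2 : mfderiv I 𝓘(ℝ, ℝ) k x = 0 := ContinuousLinearMap.ext (h x)
  rwa [h2] at h1

end Constancy

section Slices

variable {E₁ E₂ : Type*} [NormedAddCommGroup E₁] [NormedSpace ℝ E₁] [NormedAddCommGroup E₂]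
  [NormedSpace ℝ E₂]

theorem hasFDerivAt_slice_left {k : E₁ × E₂ → ℝ} {a : E₁} {b : E₂}
    (hk : DifferentiableAt ℝ k (a, b)) :
    HasFDerivAt (fun a' => k (a', b)) (fderiv ℝ k (a, b) ∘L ContinuousLinearMap.inl ℝ E₁ E₂) a :=
  HasFDerivAt.comp a hk.hasFDerivAt (hasFDerivAt_prodMk_left a b)

theorem hasFDerivAt_slice_right {k : E₁ × E₂ → ℝ} {a : E₁} {b : E₂}
    (hk : DifferentiableAt ℝ k (a, b)) :
    HasFDerivAt (fun b' => k (a, b')) (fderiv ℝ k (a, b) ∘L ContinuousLinearMap.inr ℝ E₁ E₂) b :=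
  HasFDerivAt.comp b hk.hasFDerivAt (hasFDerivAt_prodMk_right a b)

theorem fderiv_fderiv_slice_left {k : E₁ × E₂ → ℝ} {a : E₁} {b : E₂}
    (hk : ContDiffAt ℝ ∞ k (a, b)) (u v : E₁) :
    fderiv ℝ (fderiv ℝ fun a' => k (a', b)) a u v = fderiv ℝ (fderiv ℝ k) (a, b) (u, 0) (v, 0) := by
  have hev : ∀ᶠ a' in 𝓝 a, ContDiffAt ℝ 1 k (a', b) := by
    have h1 : ∀ᶠ z in 𝓝 (a, b), ContDiffAt ℝ 1 k z :=
      (hk.of_le (by simp)).eventually (by simp)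
    exact (Continuous.prodMk_left b).continuousAt.eventually h1
  have h2 : (fderiv ℝ fun a' => k (a', b)) =ᶠ[𝓝 a] fun a' =>
      fderiv ℝ k (a', b) ∘L ContinuousLinearMap.inl ℝ E₁ E₂ := by
    filter_upwards [hev] with a' ha'
    exact (hasFDerivAt_slice_left (ha'.differentiableAt (by simp))).fderiv
  have h3 : DifferentiableAt ℝ (fderiv ℝ k) (a, b) :=
    (hk.fderiv_right (m := ∞) (by simp)).differentiableAt (by simp)
  have h4 : HasFDerivAt (fun a' => fderiv ℝ k (a', b))
      (fderiv ℝ (fderiv ℝ k) (a, b) ∘L ContinuousLinearMap.inl ℝ E₁ E₂) a :=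
    HasFDerivAt.comp a h3.hasFDerivAt (hasFDerivAt_prodMk_left a b)
  have h5 := h4.clm_comp (hasFDerivAt_const (ContinuousLinearMap.inl ℝ E₁ E₂) a)
  rw [h2.fderiv_eq, h5.fderiv]
  simp

end Slices

section WarpedEquation

variable {E₁ : Type*} [NormedAddCommGroup E₁] [NormedSpace ℝ E₁] [FiniteDimensional ℝ E₁]
  {H₁ : Type*} [TopologicalSpace H₁] {I₁ : ModelWithCorners ℝ E₁ H₁} [I₁.Boundaryless]
  {B : Type*} [TopologicalSpace B] [ChartedSpace H₁ B] [IsManifold I₁ ∞ B]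
  {E₂ : Type*} [NormedAddCommGroup E₂] [NormedSpace ℝ E₂] [FiniteDimensional ℝ E₂]
  {H₂ : Type*} [TopologicalSpace H₂] {I₂ : ModelWithCorners ℝ E₂ H₂} [I₂.Boundaryless]
  {F : Type*} [TopologicalSpace F] [ChartedSpace H₂ F] [IsManifold I₂ ∞ F]
  (gB : Metric I₁ B) (f : B → ℝ) (hf : ContMDiff I₁ 𝓘(ℝ, ℝ) ∞ f) (hpos : ∀ x, 0 < f x)
  (gF : Metric I₂ F)

omit [FiniteDimensional ℝ E₁] [FiniteDimensional ℝ E₂] in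
theorem inChart_warpedMetric_eventuallyEq (x : B) (y : F) :
    inChart (warpedMetric gB f hf hpos gF) (x, y) =ᶠ[𝓝 (extChartAt I₁ x x, extChartAt I₂ y y)]
      CoordMetric.warped (inChart gB x) (f ∘ (extChartAt I₁ x).symm) (inChart gF y) := by
  have h := ((isOpen_extChartAt_target (I := I₁) x).prod
    (isOpen_extChartAt_target (I := I₂) y)).mem_nhds
    (Set.mk_mem_prod (mem_extChartAt_target (I := I₁) x) (mem_extChartAt_target (I := I₂) y))
  filter_upwards [h] with z hz using inChart_warpedMetric gB f hf hpos gF x y hz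

theorem scalar_warpedMetric (x : B) (y : F) :
    f x ^ 2 * scalar (warpedMetric gB f hf hpos gF) (x, y) =
      scalar gF y + CoordMetric.warpedScalarCoeff (inChart gB x) (f ∘ (extChartAt I₁ x).symm)
        (Module.finrank ℝ E₂) (extChartAt I₁ x x) := by
  have h := CoordMetric.scalar_warped (isMetricOn_inChart gB x) (isMetricOn_inChart gF y)
    (contDiffOn_comp_extChartAt_symm hf x) (fun _ _ => hpos _)
    (Set.mk_mem_prod (mem_extChartAt_target (I := I₁) x) (mem_extChartAt_target (I := I₂) y))
  rw [← CoordMetric.scalar_congr (inChart_warpedMetric_eventuallyEq gB f hf hpos gF x y)] at h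
  simp only [Function.comp_apply, extChartAt_to_inv] at h
  rw [scalar, extChartAt_prod_apply]
  exact h

theorem ricci_warpedMetric (x : B) (y : F) (u v : E₁ × E₂) :
    ricci (warpedMetric gB f hf hpos gF) (x, y) u v =
      CoordMetric.ricci (inChart gB x) (extChartAt I₁ x x) u.1 v.1 -
        Module.finrank ℝ E₂ * CoordMetric.logHessian (inChart gB x)
          (f ∘ (extChartAt I₁ x).symm) (extChartAt I₁ x x) u.1 v.1 +
      (CoordMetric.ricci (inChart gF y) (extChartAt I₂ y y) u.2 v.2 +
        CoordMetric.warpedRicciCoeff (inChart gB x) (f ∘ (extChartAt I₁ x).symm)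
          (Module.finrank ℝ E₂) (extChartAt I₁ x x) *
          inChart gF y (extChartAt I₂ y y) u.2 v.2) := by
  have h := CoordMetric.ricci_warped (isMetricOn_inChart gB x) (isMetricOn_inChart gF y)
    (contDiffOn_comp_extChartAt_symm hf x) (fun _ _ => hpos _)
    (Set.mk_mem_prod (mem_extChartAt_target (I := I₁) x) (mem_extChartAt_target (I := I₂) y)) u v
  rw [← CoordMetric.ricci_congr (inChart_warpedMetric_eventuallyEq gB f hf hpos gF x y)] at h
  refine (ricci_eq_coord _ _ _ _).trans ?_
  rw [extChartAt_prod_apply]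
  exact h

theorem christoffel_warpedMetric (x : B) (y : F) (u v : E₁ × E₂) :
    CoordMetric.christoffel (inChart (warpedMetric gB f hf hpos gF) (x, y))
      (extChartAt (I₁.prod I₂) (x, y) (x, y)) u v =
      (CoordMetric.christoffel (inChart gB x) (extChartAt I₁ x x) u.1 v.1 -
          inChart gF y (extChartAt I₂ y y) u.2 v.2 • CoordMetric.halfGradSq (inChart gB x)
            (f ∘ (extChartAt I₁ x).symm) (extChartAt I₁ x x),
        CoordMetric.christoffel (inChart gF y) (extChartAt I₂ y y) u.2 v.2 +
          CoordMetric.logDiff (f ∘ (extChartAt I₁ x).symm) (extChartAt I₁ x x) u.1 • v.2 +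
          CoordMetric.logDiff (f ∘ (extChartAt I₁ x).symm) (extChartAt I₁ x x) v.1 • u.2) := by
  have h := CoordMetric.christoffel_warped (isMetricOn_inChart gB x) (isMetricOn_inChart gF y)
    (contDiffOn_comp_extChartAt_symm hf x) (fun _ _ => hpos _)
    (Set.mk_mem_prod (mem_extChartAt_target (I := I₁) x) (mem_extChartAt_target (I := I₂) y)) u v
  rw [← CoordMetric.christoffel_congr (inChart_warpedMetric_eventuallyEq gB f hf hpos gF x y)] at h
  rw [extChartAt_prod_apply]
  exact h

omit [FiniteDimensional ℝ E₁] [FiniteDimensional ℝ E₂] [I₁.Boundaryless] [I₂.Boundaryless] in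
theorem warpedMetric_inner (x : B) (y : F) (u v : E₁ × E₂) :
    (warpedMetric gB f hf hpos gF).inner (x, y) u v =
      gB.inner x u.1 v.1 + f x ^ 2 * gF.inner y u.2 v.2 := by
  refine (warpedForm_apply gB f gF (x, y) u v).trans ?_
  rw [mfderiv_fst, mfderiv_snd]
  rfl

omit [FiniteDimensional ℝ E₁] [FiniteDimensional ℝ E₂] [I₁.Boundaryless] [I₂.Boundaryless] in
theorem warpedMetric_inner_horizontal (x : B) (y : F) (u v : E₁) :
    (warpedMetric gB f hf hpos gF).inner (x, y) ((u, 0) : E₁ × E₂) ((v, 0) : E₁ × E₂) =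
      gB.inner x u v := by
  refine (warpedMetric_inner gB f hf hpos gF x y (u, 0) (v, 0)).trans ?_
  have h0 : gF.inner y (0 : TangentSpace I₂ y) (0 : TangentSpace I₂ y) = 0 := map_zero _
  change gB.inner x u v + f x ^ 2 * gF.inner y (0 : TangentSpace I₂ y) (0 : TangentSpace I₂ y) = _
  rw [h0, mul_zero, add_zero]

omit [FiniteDimensional ℝ E₁] [FiniteDimensional ℝ E₂] [I₁.Boundaryless] [I₂.Boundaryless] in
theorem warpedMetric_inner_mixed (x : B) (y : F) (u : E₁) (v : E₂) :
    (warpedMetric gB f hf hpos gF).inner (x, y) ((u, 0) : E₁ × E₂) ((0, v) : E₁ × E₂) = 0 := by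
  refine (warpedMetric_inner gB f hf hpos gF x y (u, 0) (0, v)).trans ?_
  have h0 : gB.inner x u (0 : TangentSpace I₁ x) = 0 := map_zero _
  have h0' : gF.inner y (0 : TangentSpace I₂ y) v = 0 := by rw [map_zero]; rfl
  change gB.inner x u (0 : TangentSpace I₁ x) +
    f x ^ 2 * gF.inner y (0 : TangentSpace I₂ y) v = _
  rw [h0, h0', mul_zero, add_zero]

omit [FiniteDimensional ℝ E₁] [FiniteDimensional ℝ E₂] [I₁.Boundaryless] [I₂.Boundaryless]
  [IsManifold I₁ ∞ B] [IsManifold I₂ ∞ F] in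
theorem comp_extChartAt_symm_slice_left (h : B × F → ℝ) (x : B) (y : F) :
    (fun a => (h ∘ (extChartAt (I₁.prod I₂) (x, y)).symm) (a, extChartAt I₂ y y)) =
      (fun x' => h (x', y)) ∘ (extChartAt I₁ x).symm := by
  funext a
  have h1 := congrFun (extChartAt_prod_symm (I₁ := I₁) (I₂ := I₂) x y) (a, extChartAt I₂ y y)
  rw [Prod.map_apply, extChartAt_to_inv] at h1
  exact congrArg h h1

omit [FiniteDimensional ℝ E₁] [FiniteDimensional ℝ E₂] in
theorem contDiffAt_comp_extChartAt_prod_symm {h : B × F → ℝ}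
    (hh : ContMDiff (I₁.prod I₂) 𝓘(ℝ, ℝ) ∞ h) {x : B} {y : F} {z : E₁ × E₂}
    (hz : z ∈ (extChartAt I₁ x).target ×ˢ (extChartAt I₂ y).target) :
    ContDiffAt ℝ ∞ (h ∘ (extChartAt (I₁.prod I₂) (x, y)).symm) z := by
  rw [← extChartAt_prod_target] at hz
  exact (contDiffOn_comp_extChartAt_symm hh (x, y)).contDiffAt
    ((isOpen_extChartAt_target _).mem_nhds hz)

/-- The slices `B × {y}` are totally geodesic: the Christoffel symbol of two horizontal vectors is
the one of the base, with no fibre component. -/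
theorem hessian_warpedMetric_horizontal {h : B × F → ℝ}
    (hh : ContMDiff (I₁.prod I₂) 𝓘(ℝ, ℝ) ∞ h) (x : B) (y : F) (u v : E₁) :
    hessian (warpedMetric gB f hf hpos gF) h (x, y) ((u, 0) : E₁ × E₂) ((v, 0) : E₁ × E₂) =
      hessian gB (fun x' => h (x', y)) x u v := by
  have hz := Set.mk_mem_prod (mem_extChartAt_target (I := I₁) x) (mem_extChartAt_target (I := I₂) y)
  have hk := contDiffAt_comp_extChartAt_prod_symm (I₁ := I₁) (I₂ := I₂) hh hz
  refine (hessian_eq_coord _ _ _ _ _).trans (Eq.trans ?_ (hessian_eq_coord _ _ _ _ _).symm)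
  rw [CoordMetric.hessian, CoordMetric.hessian, ← comp_extChartAt_symm_slice_left (I₂ := I₂), fderiv_fderiv_slice_left hk,
    (hasFDerivAt_slice_left (hk.differentiableAt (by simp))).fderiv]
  erw [christoffel_warpedMetric gB f hf hpos gF x y (u, 0) (v, 0)]
  rw [extChartAt_prod_apply]
  simp [-extChartAt]

/-- The Christoffel symbol of `(u, 0)` and `(0, v)` is `(0, (df(u) / f) v)`. The right-hand side is
thus `f` times the derivative along `u` of (vertical derivative of `h`) / `f`. -/
theorem hessian_warpedMetric_mixed (h : B × F → ℝ) (x : B) (y : F) (u : E₁) (v : E₂) :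
    hessian (warpedMetric gB f hf hpos gF) h (x, y) ((u, 0) : E₁ × E₂) ((0, v) : E₁ × E₂) =
      fderiv ℝ (fderiv ℝ (h ∘ (extChartAt (I₁.prod I₂) (x, y)).symm))
        (extChartAt I₁ x x, extChartAt I₂ y y) (u, 0) (0, v) -
      CoordMetric.logDiff (f ∘ (extChartAt I₁ x).symm) (extChartAt I₁ x x) u *
        fderiv ℝ (h ∘ (extChartAt (I₁.prod I₂) (x, y)).symm)
          (extChartAt I₁ x x, extChartAt I₂ y y) (0, v) := by
  refine (hessian_eq_coord _ _ _ _ _).trans ?_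
  rw [CoordMetric.hessian]
  erw [christoffel_warpedMetric gB f hf hpos gF x y (u, 0) (0, v)]
  rw [extChartAt_prod_apply]
  have : ((0, CoordMetric.logDiff (f ∘ (extChartAt I₁ x).symm) (extChartAt I₁ x x) u • v) :
      E₁ × E₂) = CoordMetric.logDiff (f ∘ (extChartAt I₁ x).symm) (extChartAt I₁ x x) u •
        ((0, v) : E₁ × E₂) := by simp
  simp only [map_zero, _root_.zero_apply, zero_smul, sub_zero, zero_add, add_zero, this, map_smul,
    smul_eq_mul]

omit [FiniteDimensional ℝ E₁] [FiniteDimensional ℝ E₂] in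
theorem differential_horizontal {h : B × F → ℝ}
    (hh : ContMDiff (I₁.prod I₂) 𝓘(ℝ, ℝ) ∞ h) (x : B) (y : F) (u : E₁) :
    differential (I₁.prod I₂) h (x, y) ((u, 0) : E₁ × E₂) =
      differential I₁ (fun x' => h (x', y)) x u := by
  have hz := Set.mk_mem_prod (mem_extChartAt_target (I := I₁) x) (mem_extChartAt_target (I := I₂) y)
  have hk := contDiffAt_comp_extChartAt_prod_symm (I₁ := I₁) (I₂ := I₂) hh hz
  have hs : ContMDiff I₁ 𝓘(ℝ, ℝ) ∞ (fun x' => h (x', y)) :=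
    hh.comp (contMDiff_id.prodMk contMDiff_const)
  refine (differential_eq_coord ((hh _).mdifferentiableAt (by simp)) _).trans
    (Eq.trans ?_ (differential_eq_coord ((hs _).mdifferentiableAt (by simp)) _).symm)
  rw [← comp_extChartAt_symm_slice_left (I₂ := I₂),
    (hasFDerivAt_slice_left (hk.differentiableAt (by simp))).fderiv, extChartAt_prod_apply]
  rfl

variable {gB f hf hpos gF}
variable {α β μ ρ : ℝ} {h lam : B × F → ℝ}

theorem IsGradientEinsteinType.horizontal
    (hE : IsGradientEinsteinType (warpedMetric gB f hf hpos gF) α β μ ρ h lam)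
    (x : B) (y : F) (u : E₁) :
    α * (CoordMetric.ricci (inChart gB x) (extChartAt I₁ x x) u u -
        Module.finrank ℝ E₂ * CoordMetric.logHessian (inChart gB x)
          (f ∘ (extChartAt I₁ x).symm) (extChartAt I₁ x x) u u) +
      β * hessian gB (fun x' => h (x', y)) x u u +
      μ * (differential I₁ (fun x' => h (x', y)) x u *
        differential I₁ (fun x' => h (x', y)) x u) =
    (ρ * scalar (warpedMetric gB f hf hpos gF) (x, y) + lam (x, y)) * gB.inner x u u := by
  have e := hE.equation (x, y) ((u, 0) : E₁ × E₂) ((u, 0) : E₁ × E₂)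
  rw [hessian_warpedMetric_horizontal gB f hf hpos gF hE.smooth_potential,
    differential_horizontal hE.smooth_potential, ricci_warpedMetric,
    warpedMetric_inner_horizontal] at e
  simpa [-extChartAt] using! e

/-- Neither the Ricci tensor nor the metric has mixed components, so for `μ = 0` only the Hessian
term survives. For `μ ≠ 0` a product of differentials of `h` would remain. -/
theorem IsGradientEinsteinType.mixed
    (hE : IsGradientEinsteinType (warpedMetric gB f hf hpos gF) α β 0 ρ h lam) (hβ : β ≠ 0)
    (x : B) (y : F) (u : E₁) (v : E₂) :
    fderiv ℝ (fderiv ℝ (h ∘ (extChartAt (I₁.prod I₂) (x, y)).symm))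
        (extChartAt I₁ x x, extChartAt I₂ y y) (u, 0) (0, v) =
      CoordMetric.logDiff (f ∘ (extChartAt I₁ x).symm) (extChartAt I₁ x x) u *
        fderiv ℝ (h ∘ (extChartAt (I₁.prod I₂) (x, y)).symm)
          (extChartAt I₁ x x, extChartAt I₂ y y) (0, v) := by
  have e := hE.equation (x, y) ((u, 0) : E₁ × E₂) ((0, v) : E₁ × E₂)
  rw [hessian_warpedMetric_mixed gB f hf hpos gF, ricci_warpedMetric,
    warpedMetric_inner_mixed] at e
  simp only [map_zero, _root_.zero_apply, LinearMap.zero_apply, mul_zero, zero_mul, add_zero,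
    sub_zero, zero_add] at e
  exact sub_eq_zero.1 ((mul_eq_zero.1 e).resolve_left hβ)

end WarpedEquation

end Riem
-- Consequences for the potential function
namespace Riem

section HessianLinear

variable {E : Type*} [NormedAddCommGroup E] [NormedSpace ℝ E]
  {H : Type*} [TopologicalSpace H] {I : ModelWithCorners ℝ E H} [I.Boundaryless]
  {M : Type*} [TopologicalSpace M] [ChartedSpace H M] [IsManifold I ∞ M]

theorem contDiffAt_comp_extChartAt_symm {k : M → ℝ} (hk : ContMDiff I 𝓘(ℝ, ℝ) ∞ k) (p : M) :
    ContDiffAt ℝ ∞ (k ∘ (extChartAt I p).symm) (extChartAt I p p) :=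
  (contDiffOn_comp_extChartAt_symm hk p).contDiffAt
    ((isOpen_extChartAt_target p).mem_nhds (mem_extChartAt_target p))

theorem hessian_add_mul (g : Metric I M) {k l : M → ℝ} (hk : ContMDiff I 𝓘(ℝ, ℝ) ∞ k)
    (hl : ContMDiff I 𝓘(ℝ, ℝ) ∞ l) (c : ℝ) (p : M) (u v : TangentSpace I p) :
    hessian g (fun q => k q + l q * c) p u v = hessian g k p u v + c * hessian g l p u v := by
  have h1 := contDiffAt_comp_extChartAt_symm hk p
  have h2 := contDiffAt_comp_extChartAt_symm hl p
  have hev (q : M → ℝ) (hq : ContDiffAt ℝ ∞ (q ∘ (extChartAt I p).symm) (extChartAt I p p)) :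
      ∀ᶠ a in 𝓝 (extChartAt I p p), DifferentiableAt ℝ (q ∘ (extChartAt I p).symm) a :=
    ((hq.of_le (by simp : (1 : WithTop ℕ∞) ≤ ∞)).eventually (by simp)).mono
      fun a ha => ha.differentiableAt (by simp)
  have h3 : fderiv ℝ ((fun q => k q + l q * c) ∘ (extChartAt I p).symm) =ᶠ[𝓝 (extChartAt I p p)]
      fun a => fderiv ℝ (k ∘ (extChartAt I p).symm) a +
        c • fderiv ℝ (l ∘ (extChartAt I p).symm) a := by
    filter_upwards [hev k h1, hev l h2] with a ha hb
    exact (ha.hasFDerivAt.add (hb.hasFDerivAt.mul_const c)).fderiv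
  have h4 := ((h1.fderiv_right (m := ∞) (by simp)).differentiableAt (by simp)).hasFDerivAt.add
    (((h2.fderiv_right (m := ∞) (by simp)).differentiableAt (by simp)).hasFDerivAt.const_smul c)
  rw [hessian, hessian, hessian, CoordMetric.hessian, CoordMetric.hessian, CoordMetric.hessian,
    h3.fderiv_eq, h3.eq_of_nhds]
  erw [h4.fderiv]
  simp only [_root_.add_apply, _root_.smul_apply, smul_eq_mul]
  ring

end HessianLinear

section Potential

variable {E₁ : Type*} [NormedAddCommGroup E₁] [NormedSpace ℝ E₁] [FiniteDimensional ℝ E₁]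
  {H₁ : Type*} [TopologicalSpace H₁] {I₁ : ModelWithCorners ℝ E₁ H₁} [I₁.Boundaryless]
  {B : Type*} [TopologicalSpace B] [ChartedSpace H₁ B] [IsManifold I₁ ∞ B]
  {E₂ : Type*} [NormedAddCommGroup E₂] [NormedSpace ℝ E₂] [FiniteDimensional ℝ E₂]
  {H₂ : Type*} [TopologicalSpace H₂] {I₂ : ModelWithCorners ℝ E₂ H₂} [I₂.Boundaryless]
  {F : Type*} [TopologicalSpace F] [ChartedSpace H₂ F] [IsManifold I₂ ∞ F]
  {gB : Metric I₁ B} {f : B → ℝ} {hf : ContMDiff I₁ 𝓘(ℝ, ℝ) ∞ f} {hpos : ∀ x, 0 < f x}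
  {gF : Metric I₂ F} {α β μ ρ : ℝ} {h lam : B × F → ℝ}

/-- If the potential function is a lift, then so is `ρ R_F + λ f²`. -/
theorem IsGradientEinsteinType.isLiftOfSmooth_soliton [ConnectedSpace B] [Nonempty F]
    (hE : IsGradientEinsteinType (warpedMetric gB f hf hpos gF) α β μ ρ h lam)
    (hconst : ¬ ∃ c : ℝ, ∀ x, f x = c) (hlift : IsLiftOfSmooth I₁ h) :
    IsLiftOfSmooth I₁ (fun p : B × F => ρ * scalar gF p.2 + lam p * f p.1 ^ 2) := by
  obtain ⟨k, -, hkh⟩ := hlift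
  obtain ⟨x₀, u, hu⟩ := exists_differential_ne_zero hf hconst
  have hu0 : (u : E₁) ≠ 0 := by
    rintro rfl
    exact hu (map_zero _)
  obtain ⟨y₀⟩ := ‹Nonempty F›
  -- Freezing the fibre point makes `scalar gF y₀` a constant, so smoothness of the fibre scalar
  -- curvature is never needed.
  refine ⟨fun x => ρ * scalar gF y₀ + lam (x, y₀) * f x ^ 2, ?_, fun x y => ?_⟩
  · exact contMDiff_const.add ((hE.smooth_soliton.comp
      (contMDiff_id.prodMk contMDiff_const)).mul (hf.pow 2))
  -- All tangent spaces of `B` are the same model space, so the nonzero vector found at `x₀` serves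
  -- at every `x`.
  have e₁ := hE.horizontal x y u
  have e₀ := hE.horizontal x y₀ u
  have hk (y : F) : (fun x' => h (x', y)) = k := funext fun x' => hkh x' y
  rw [hk] at e₁ e₀
  have hΛ := mul_right_cancel₀ (gB.pos x u hu0).ne' (e₁.symm.trans e₀)
  have s₁ := scalar_warpedMetric gB f hf hpos gF x y
  have s₀ := scalar_warpedMetric gB f hf hpos gF x y₀
  simp only
  linear_combination f x ^ 2 * hΛ - ρ * s₁ + ρ * s₀

/-- The vertical derivative of the potential function divided by `f` does not depend on the
base point. -/
theorem IsGradientEinsteinType.differential_vertical_div [ConnectedSpace B]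
    (hE : IsGradientEinsteinType (warpedMetric gB f hf hpos gF) α β 0 ρ h lam) (hβ : β ≠ 0)
    (x x' : B) (y : F) (v : TangentSpace I₂ y) :
    differential I₂ (fun y' => h (x, y')) y v / f x =
      differential I₂ (fun y' => h (x', y')) y v / f x' := by
  have hh := hE.smooth_potential
  refine eq_of_hasMFDerivAt_zero (I := I₁)
    (k := fun x => differential I₂ (fun y' => h (x, y')) y v / f x) (fun x => ?_) x x'
  have hz := Set.mk_mem_prod (mem_extChartAt_target (I := I₁) x) (mem_extChartAt_target (I := I₂) y)
  have hk := contDiffAt_comp_extChartAt_prod_symm (I₁ := I₁) (I₂ := I₂) hh hz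
  set k := h ∘ (extChartAt (I₁.prod I₂) (x, y)).symm with hkdef
  set a₀ := extChartAt I₁ x x with ha₀
  set b₀ := extChartAt I₂ y y with hb₀
  have hfx : f x ≠ 0 := (hpos x).ne'
  have hfa : (f ∘ (extChartAt I₁ x).symm) a₀ = f x := by
    rw [Function.comp_apply, ha₀, extChartAt_to_inv]
  -- In the product chart, the product rule and the mixed equation make the derivative of the
  -- quotient vanish.
  have hr : HasFDerivAt (fun a => fderiv ℝ k (a, b₀) ((0 : E₁), (v : E₂)) *
      ((f ∘ (extChartAt I₁ x).symm) a)⁻¹) (0 : E₁ →L[ℝ] ℝ) a₀ := by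
    have h1 : DifferentiableAt ℝ (fderiv ℝ k) (a₀, b₀) :=
      (hk.fderiv_right (m := ∞) (by simp)).differentiableAt (by simp)
    have h2 : HasFDerivAt (fun a => fderiv ℝ k (a, b₀))
        (fderiv ℝ (fderiv ℝ k) (a₀, b₀) ∘L ContinuousLinearMap.inl ℝ E₁ E₂) a₀ :=
      HasFDerivAt.comp a₀ h1.hasFDerivAt (hasFDerivAt_prodMk_left a₀ b₀)
    have h3 := h2.clm_apply (hasFDerivAt_const ((0 : E₁), (v : E₂)) a₀)
    have h4 := (contDiffAt_comp_extChartAt_symm hf x).differentiableAt (by simp) |>.hasFDerivAt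
    have h5 := (hasDerivAt_inv (by rwa [hfa])).comp_hasFDerivAt a₀ h4
    have e (u : E₁) := hE.mixed hβ x y u v
    simp only [← hkdef, ← ha₀, ← hb₀, CoordMetric.logDiff] at e
    refine (h3.mul h5).congr_fderiv (ContinuousLinearMap.ext fun u => ?_)
    have e' : fderiv ℝ (fderiv ℝ k) (a₀, b₀) (u, 0) ((0 : E₁), (v : E₂)) = (f x)⁻¹ *
        fderiv ℝ (f ∘ (extChartAt I₁ x).symm) a₀ u * fderiv ℝ k (a₀, b₀) ((0 : E₁), (v : E₂)) := by
      rw [← hfa]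
      exact e u
    have h6 : fderiv ℝ k (a₀, b₀) ((0 : E₁), (v : E₂)) *
        (-((f x) ^ 2)⁻¹ * fderiv ℝ (f ∘ (extChartAt I₁ x).symm) a₀ u) + (f x)⁻¹ *
        (fderiv ℝ k (a₀, b₀) 0 +
          fderiv ℝ (fderiv ℝ k) (a₀, b₀) (u, 0) ((0 : E₁), (v : E₂))) = 0 := by
      rw [e', map_zero]
      field_simp
      ring
    rw [← hfa] at h6
    exact h6
  -- The quotient must be expressed in the fixed chart at `x` for all nearby base points, not just
  -- at its centre.
  have hev : (fun x => differential I₂ (fun y' => h (x, y')) y v / f x) =ᶠ[𝓝 x]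
      (fun a => fderiv ℝ k (a, b₀) ((0 : E₁), (v : E₂)) *
        ((f ∘ (extChartAt I₁ x).symm) a)⁻¹) ∘ extChartAt I₁ x := by
    filter_upwards [extChartAt_source_mem_nhds (I := I₁) x] with q hq
    have hs : ContMDiff I₂ 𝓘(ℝ, ℝ) ∞ (fun y' => h (q, y')) :=
      hh.comp (contMDiff_const.prodMk contMDiff_id)
    have hz' := Set.mk_mem_prod ((extChartAt I₁ x).map_source hq)
      (mem_extChartAt_target (I := I₂) y)
    have hk' := contDiffAt_comp_extChartAt_prod_symm (I₁ := I₁) (I₂ := I₂) hh hz'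
    have hslice : (fun y' => h (q, y')) ∘ (extChartAt I₂ y).symm =
        fun b => k (extChartAt I₁ x q, b) := by
      funext b
      have h1 := congrFun (extChartAt_prod_symm (I₁ := I₁) (I₂ := I₂) x y) (extChartAt I₁ x q, b)
      rw [Prod.map_apply, (extChartAt I₁ x).left_inv hq] at h1
      exact (congrArg h h1).symm
    have hd : differential I₂ (fun y' => h (q, y')) y v =
        fderiv ℝ k (extChartAt I₁ x q, b₀) ((0 : E₁), (v : E₂)) := by
      rw [differential_eq_coord ((hs y).mdifferentiableAt (by simp)), hslice,
        (hasFDerivAt_slice_right (hk'.differentiableAt (by simp))).fderiv]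
      rfl
    rw [Function.comp_apply, Function.comp_apply, (extChartAt I₁ x).left_inv hq, hd, div_eq_mul_inv]
  have : IsManifold I₁ 1 B := IsManifold.of_le (n := ∞) (by simp)
  have hc := HasMFDerivAt.comp x hr.hasMFDerivAt
    (mdifferentiableAt_extChartAt (I := I₁) (mem_chart_source H₁ x)).hasMFDerivAt
  have hc' := hc.congr_of_eventuallyEq hev
  exact hc'.congr_mfderiv (ContinuousLinearMap.ext fun u => rfl)

/-- The potential function has the form `h(x, y) = h(x, y₀) + f(x) ψ(y)`. -/
theorem IsGradientEinsteinType.exists_potential_eq [ConnectedSpace B] [ConnectedSpace F]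
    (hE : IsGradientEinsteinType (warpedMetric gB f hf hpos gF) α β 0 ρ h lam) (hβ : β ≠ 0)
    (y₀ : F) : ∃ ψ : F → ℝ, ∀ x y, h (x, y) = h (x, y₀) + f x * ψ y := by
  obtain ⟨x₀⟩ : Nonempty B := inferInstance
  refine ⟨fun y => (h (x₀, y) - h (x₀, y₀)) / f x₀, fun x y => ?_⟩
  have hs (x : B) : ContMDiff I₂ 𝓘(ℝ, ℝ) ∞ (fun y' => h (x, y')) :=
    hE.smooth_potential.comp (contMDiff_const.prodMk contMDiff_id)
  -- Since (vertical derivative) / `f` is the same at `x` and `x₀`, this combination of two slices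
  -- has zero differential on the connected fibre.
  have key := eq_of_hasMFDerivAt_zero (I := I₂)
    (k := fun y => h (x, y) - f x / f x₀ * h (x₀, y)) (fun y => ?_) y y₀
  · have h0 := (hpos x₀).ne'
    field_simp at key ⊢
    linarith
  · have h1 := ((hs x y).mdifferentiableAt (by simp)).hasMFDerivAt
    have h2 := ((hs x₀ y).mdifferentiableAt (by simp)).hasMFDerivAt
    have h3 := h1.sub (h2.const_smul (f x / f x₀))
    refine h3.congr_mfderiv (ContinuousLinearMap.ext fun v => ?_)
    have e := hE.differential_vertical_div hβ x x₀ y v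
    have h0 := (hpos x₀).ne'
    have h0' := (hpos x).ne'
    have e' : differential I₂ (fun y' => h (x, y')) y v -
        f x / f x₀ * differential I₂ (fun y' => h (x₀, y')) y v = 0 := by
      field_simp at e ⊢
      linarith
    exact e'

/-- If `ρ R_F + λ f²` is a lift and the potential function is not, then `f` has zero Hessian. -/
theorem IsGradientEinsteinType.hessian_eq_zero
    (hE : IsGradientEinsteinType (warpedMetric gB f hf hpos gF) α β 0 ρ h lam) (hβ : β ≠ 0)
    (hlift : IsLiftOfSmooth I₁ (fun p : B × F => ρ * scalar gF p.2 + lam p * f p.1 ^ 2))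
    {ψ : F → ℝ} {y₀ y₁ : F} (hψ : ∀ x y, h (x, y) = h (x, y₀) + f x * ψ y) (hy₁ : ψ y₁ ≠ 0)
    (x : B) (u : TangentSpace I₁ x) : hessian gB f x u u = 0 := by
  obtain ⟨k, -, hk⟩ := hlift
  have e₁ := hE.horizontal x y₁ u
  have e₀ := hE.horizontal x y₀ u
  have s₁ := scalar_warpedMetric gB f hf hpos gF x y₁
  have s₀ := scalar_warpedMetric gB f hf hpos gF x y₀
  have k₁ := hk x y₁
  have k₀ := hk x y₀
  simp only at k₁ k₀
  -- After multiplication by `f²`, the two sides differ from the values of `ρ R_F + λ f²` by the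
  -- same function on the base.
  have hΛ : ρ * scalar (warpedMetric gB f hf hpos gF) (x, y₁) + lam (x, y₁) =
      ρ * scalar (warpedMetric gB f hf hpos gF) (x, y₀) + lam (x, y₀) := by
    refine mul_left_cancel₀ (pow_ne_zero 2 (hpos x).ne') ?_
    linear_combination ρ * s₁ - ρ * s₀ + k₁ - k₀
  rw [hΛ] at e₁
  have hs : ContMDiff I₁ 𝓘(ℝ, ℝ) ∞ (fun x' => h (x', y₀)) :=
    hE.smooth_potential.comp (contMDiff_id.prodMk contMDiff_const)
  have hfun : (fun x' => h (x', y₁)) = fun x' => h (x', y₀) + f x' * ψ y₁ :=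
    funext fun x' => hψ x' y₁
  rw [hfun, hessian_add_mul gB hs hf] at e₁
  -- The Ricci terms, the right-hand sides and the Hessian of `h(·, y₀)` cancel in the difference.
  have : β * (ψ y₁ * hessian gB f x u u) = 0 := by linear_combination e₁ - e₀
  exact (mul_eq_zero.1 ((mul_eq_zero.1 this).resolve_left hβ)).resolve_left hy₁

end Potential

end Riem
-- Geodesics of warped products in coordinates
namespace CoordMetric

section Curves

variable {E₁ : Type*} [NormedAddCommGroup E₁] [NormedSpace ℝ E₁]
  {E₂ : Type*} [NormedAddCommGroup E₂] [NormedSpace ℝ E₂] [FiniteDimensional ℝ E₂]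

theorem contDiffAt_deriv {X : Type*} [NormedAddCommGroup X] [NormedSpace ℝ X] {c : ℝ → X} {t : ℝ}
    (hc : ContDiffAt ℝ ∞ c t) : ContDiffAt ℝ ∞ (deriv c) t :=
  ((hc.fderiv_right (m := ∞) (by simp)).clm_apply contDiffAt_const).congr_of_eventuallyEq
    (Filter.Eventually.of_forall fun _ => fderiv_apply_one_eq_deriv.symm)

/-- Along a curve whose fibre component satisfies the geodesic equation of the warped product, the
quantity `f⁴ g_F(c₂', c₂')` is infinitesimally constant. -/
theorem hasDerivAt_fibre_energy {G : E₂ → E₂ →L[ℝ] E₂ →L[ℝ] ℝ} {V : Set E₂} {f : E₁ → ℝ}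
    {c₁ : ℝ → E₁} {c₂ : ℝ → E₂} {t : ℝ} {w : E₁} {a : E₂} (hG : IsMetricOn G V) (hc₂ : c₂ t ∈ V)
    (hf : DifferentiableAt ℝ f (c₁ t)) (h0 : f (c₁ t) ≠ 0) (hd₁ : HasDerivAt c₁ w t)
    (hd₂ : DifferentiableAt ℝ c₂ t) (hdd₂ : HasDerivAt (deriv c₂) a t)
    (ha : a + (christoffel G (c₂ t) (deriv c₂ t) (deriv c₂ t) +
      logDiff f (c₁ t) w • deriv c₂ t + logDiff f (c₁ t) w • deriv c₂ t) = 0) :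
    HasDerivAt (fun s => f (c₁ s) ^ 4 * G (c₂ s) (deriv c₂ s) (deriv c₂ s)) 0 t := by
  have h1 := (hf.hasFDerivAt.comp_hasDerivAt t hd₁).pow 4
  have h2 := (hG.differentiableAt hc₂).hasFDerivAt.comp_hasDerivAt t hd₂.hasDerivAt
  have h3 := (h2.clm_apply hdd₂).clm_apply hdd₂
  refine (h1.mul h3).congr_deriv ?_
  have ea := eq_neg_of_add_eq_zero_left ha
  have es := hG.symm _ hc₂ (deriv c₂ t) a
  have ec := hG.fderiv_eq hc₂ (deriv c₂ t) (deriv c₂ t) (deriv c₂ t)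
  -- The fibre equation reads `∇c₂' = -2 (f'/f) c₂'`, so `g_F(c₂', c₂')` has logarithmic derivative
  -- `-4 f'/f`. This is why the exponent is 4.
  have eg : G (c₂ t) a (deriv c₂ t) = -(G (c₂ t) (christoffel G (c₂ t) (deriv c₂ t) (deriv c₂ t))
      (deriv c₂ t)) - 2 * ((f (c₁ t))⁻¹ * fderiv ℝ f (c₁ t) w *
        G (c₂ t) (deriv c₂ t) (deriv c₂ t)) := by
    rw [ea]
    simp only [map_neg, map_add, map_smul, _root_.neg_apply, _root_.add_apply,
      _root_.smul_apply, smul_eq_mul, logDiff]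
    ring
  simp only [Function.comp_apply, Pi.pow_apply, _root_.add_apply, ec, es, eg]
  field_simp
  push_cast
  ring

/-- Along a geodesic, the second derivative of a function is its Hessian on the velocity. -/
theorem hasDerivAt_deriv_comp_geodesic {G : E₁ → E₁ →L[ℝ] E₁ →L[ℝ] ℝ} {f : E₁ → ℝ}
    {c : ℝ → E₁} {t : ℝ} (hf : ContDiffAt ℝ ∞ f (c t)) (hc : ContDiffAt ℝ ∞ c t)
    (hgeo : deriv (deriv c) t + christoffel G (c t) (deriv c t) (deriv c t) = 0) :
    HasDerivAt (deriv (f ∘ c)) (hessian G f (c t) (deriv c t) (deriv c t)) t := by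
  have hev₁ : ∀ᶠ s in 𝓝 t, ContDiffAt ℝ 1 c s := (hc.of_le (by simp)).eventually (by simp)
  have hev₂ : ∀ᶠ s in 𝓝 t, ContDiffAt ℝ 1 f (c s) :=
    hc.continuousAt.eventually
      ((hf.of_le (by simp : (1 : WithTop ℕ∞) ≤ ∞)).eventually (by simp))
  have h1 : deriv (f ∘ c) =ᶠ[𝓝 t] fun s => fderiv ℝ f (c s) (deriv c s) := by
    filter_upwards [hev₁, hev₂] with s hs₁ hs₂
    exact ((hs₂.differentiableAt (by simp)).hasFDerivAt.comp_hasDerivAt s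
      (hs₁.differentiableAt (by simp)).hasDerivAt).deriv
  have h2 : DifferentiableAt ℝ (fderiv ℝ f) (c t) :=
    (hf.fderiv_right (m := ∞) (by simp)).differentiableAt (by simp)
  have h3 : DifferentiableAt ℝ (deriv c) t :=
    (contDiffAt_deriv hc).differentiableAt (by simp)
  have h4 := (h2.hasFDerivAt.comp_hasDerivAt t
    (hc.differentiableAt (by simp)).hasDerivAt).clm_apply h3.hasDerivAt
  refine (h4.congr_of_eventuallyEq h1).congr_deriv ?_
  rw [eq_neg_of_add_eq_zero_left hgeo]
  simp [hessian, sub_eq_add_neg]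

end Curves

end CoordMetric
-- Horizontal geodesics and failure of completeness
namespace Riem

section Velocity

variable {E : Type*} [NormedAddCommGroup E] [NormedSpace ℝ E]
  {H : Type*} [TopologicalSpace H] {I : ModelWithCorners ℝ E H}
  {M : Type*} [TopologicalSpace M] [ChartedSpace H M]
  {E' : Type*} [NormedAddCommGroup E'] [NormedSpace ℝ E']
  {H' : Type*} [TopologicalSpace H'] {I' : ModelWithCorners ℝ E' H'}
  {N : Type*} [TopologicalSpace N] [ChartedSpace H' N]

theorem velocity_comp {γ : ℝ → M} {φ : M → N} {t : ℝ} (hφ : MDifferentiableAt I I' φ (γ t))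
    (hγ : MDifferentiableAt 𝓘(ℝ, ℝ) I γ t) :
    velocity I' (φ ∘ γ) t = mfderiv I I' φ (γ t) (velocity I γ t) :=
  congrArg (fun L => L (1 : ℝ)) (mfderiv_comp t hφ hγ)

theorem velocity_eq_deriv (c : ℝ → E) (t : ℝ) : velocity 𝓘(ℝ, E) c t = deriv c t := by
  have h : fderiv ℝ c t 1 = deriv c t := fderiv_apply_one_eq_deriv
  exact (congrArg (fun L : ℝ →L[ℝ] E => L 1) mfderiv_eq_fderiv).trans h

theorem deriv_comp_eq_differential {γ : ℝ → M} {φ : M → ℝ} {t : ℝ}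
    (hφ : MDifferentiableAt I 𝓘(ℝ, ℝ) φ (γ t)) (hγ : MDifferentiableAt 𝓘(ℝ, ℝ) I γ t) :
    deriv (φ ∘ γ) t = differential I φ (γ t) (velocity I γ t) :=
  (velocity_eq_deriv _ t).symm.trans (velocity_comp hφ hγ)

theorem mfderiv_extChartAt_velocity [IsManifold I ∞ M] {γ : ℝ → M} {p : M} {t : ℝ}
    (hγ : MDifferentiableAt 𝓘(ℝ, ℝ) I γ t) (ht : γ t ∈ (extChartAt I p).source) :
    mfderiv I 𝓘(ℝ, E) (extChartAt I p) (γ t) (velocity I γ t) = deriv (extChartAt I p ∘ γ) t := by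
  have : IsManifold I 1 M := IsManifold.of_le (n := ∞) (by simp)
  rw [extChartAt_source] at ht
  exact (velocity_comp (mdifferentiableAt_extChartAt ht) hγ).symm.trans (velocity_eq_deriv _ t)

theorem contDiffAt_extChartAt_comp [IsManifold I ∞ M] {γ : ℝ → M}
    (hγ : ContMDiff 𝓘(ℝ, ℝ) I ∞ γ) (t : ℝ) : ContDiffAt ℝ ∞ (extChartAt I (γ t) ∘ γ) t := by
  rw [← contMDiffAt_iff_contDiffAt]
  exact (contMDiffAt_extChartAt (I := I) (x := γ t)).comp t (hγ t)

end Velocity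

section WarpedGeodesic

variable {E₁ : Type*} [NormedAddCommGroup E₁] [NormedSpace ℝ E₁] [FiniteDimensional ℝ E₁]
  {H₁ : Type*} [TopologicalSpace H₁] {I₁ : ModelWithCorners ℝ E₁ H₁} [I₁.Boundaryless]
  {B : Type*} [TopologicalSpace B] [ChartedSpace H₁ B] [IsManifold I₁ ∞ B]
  {E₂ : Type*} [NormedAddCommGroup E₂] [NormedSpace ℝ E₂] [FiniteDimensional ℝ E₂]
  {H₂ : Type*} [TopologicalSpace H₂] {I₂ : ModelWithCorners ℝ E₂ H₂} [I₂.Boundaryless]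
  {F : Type*} [TopologicalSpace F] [ChartedSpace H₂ F] [IsManifold I₂ ∞ F]
  {gB : Metric I₁ B} {f : B → ℝ} {hf : ContMDiff I₁ 𝓘(ℝ, ℝ) ∞ f} {hpos : ∀ x, 0 < f x}
  {gF : Metric I₂ F} {γ : ℝ → B × F}

/-- The geodesic equation of a warped product, split into base and fibre components. -/
theorem IsGeodesic.warped_components (hγ : IsGeodesic (warpedMetric gB f hf hpos gF) γ) (t : ℝ) :
    let c₁ := extChartAt I₁ (γ t).1 ∘ Prod.fst ∘ γ
    let c₂ := extChartAt I₂ (γ t).2 ∘ Prod.snd ∘ γ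
    deriv (deriv c₁) t + (CoordMetric.christoffel (inChart gB (γ t).1) (c₁ t)
        (deriv c₁ t) (deriv c₁ t) - inChart gF (γ t).2 (c₂ t) (deriv c₂ t) (deriv c₂ t) •
          CoordMetric.halfGradSq (inChart gB (γ t).1) (f ∘ (extChartAt I₁ (γ t).1).symm)
            (c₁ t)) = 0 ∧
      deriv (deriv c₂) t + (CoordMetric.christoffel (inChart gF (γ t).2) (c₂ t)
        (deriv c₂ t) (deriv c₂ t) +
          CoordMetric.logDiff (f ∘ (extChartAt I₁ (γ t).1).symm) (c₁ t) (deriv c₁ t) •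
            deriv c₂ t +
          CoordMetric.logDiff (f ∘ (extChartAt I₁ (γ t).1).symm) (c₁ t) (deriv c₁ t) •
            deriv c₂ t) = 0 := by
  intro c₁ c₂
  have hc₁ : ContDiffAt ℝ ∞ c₁ t := contDiffAt_extChartAt_comp (contMDiff_fst.comp hγ.1) t
  have hc₂ : ContDiffAt ℝ ∞ c₂ t := contDiffAt_extChartAt_comp (contMDiff_snd.comp hγ.1) t
  have hc : extChartAt (I₁.prod I₂) (γ t) ∘ γ = fun s => (c₁ s, c₂ s) :=
    funext fun s => extChartAt_prod_apply (γ t).1 (γ t).2 (γ s)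
  have hev₁ : ∀ᶠ s in 𝓝 t, ContDiffAt ℝ 1 c₁ s := (hc₁.of_le (by simp)).eventually (by simp)
  have hev₂ : ∀ᶠ s in 𝓝 t, ContDiffAt ℝ 1 c₂ s := (hc₂.of_le (by simp)).eventually (by simp)
  have hd : deriv (fun s => (c₁ s, c₂ s)) =ᶠ[𝓝 t] fun s => (deriv c₁ s, deriv c₂ s) := by
    filter_upwards [hev₁, hev₂] with s h₁ h₂
    exact ((h₁.differentiableAt (by simp)).hasDerivAt.prodMk
      (h₂.differentiableAt (by simp)).hasDerivAt).deriv
  have hdd : deriv (deriv fun s => (c₁ s, c₂ s)) t = (deriv (deriv c₁) t, deriv (deriv c₂) t) := by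
    rw [hd.deriv_eq]
    exact (((CoordMetric.contDiffAt_deriv hc₁).differentiableAt (by simp)).hasDerivAt.prodMk
      ((CoordMetric.contDiffAt_deriv hc₂).differentiableAt (by simp)).hasDerivAt).deriv
  have e := hγ.2 t
  rw [hc, hdd, hd.eq_of_nhds] at e
  have e' := (congrArg (fun w => (deriv (deriv c₁) t, deriv (deriv c₂) t) + w)
    (christoffel_warpedMetric gB f hf hpos gF (γ t).1 (γ t).2
      (deriv c₁ t, deriv c₂ t) (deriv c₁ t, deriv c₂ t))).symm.trans e
  exact ⟨congrArg Prod.fst e', congrArg Prod.snd e'⟩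

/-- The fibre energy `f⁴ g_F(γ₂', γ₂')` of a curve. -/
noncomputable def fibreEnergy (f : B → ℝ) (gF : Metric I₂ F) (γ : ℝ → B × F) (t : ℝ) : ℝ :=
  f (γ t).1 ^ 4 * gF.inner (γ t).2 (velocity I₂ (Prod.snd ∘ γ) t) (velocity I₂ (Prod.snd ∘ γ) t)

/-- The coordinate computation is made in the charts at `γ t`; for nearby times it agrees with the
chart-free energy by `inChart_mfderiv`. -/
theorem IsGeodesic.hasDerivAt_fibreEnergy
    (hγ : IsGeodesic (warpedMetric gB f hf hpos gF) γ) (t : ℝ) :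
    HasDerivAt (fibreEnergy f gF γ) 0 t := by
  have hγ₁ := contMDiff_fst.comp hγ.1
  have hγ₂ := contMDiff_snd.comp hγ.1
  have hc₁ := contDiffAt_extChartAt_comp hγ₁ t
  have hc₂ := contDiffAt_extChartAt_comp hγ₂ t
  have e := (hγ.warped_components t).2
  have hfx := contDiffAt_comp_extChartAt_symm hf (γ t).1
  have hQ := CoordMetric.hasDerivAt_fibre_energy (f := f ∘ (extChartAt I₁ (γ t).1).symm)
    (c₁ := extChartAt I₁ (γ t).1 ∘ Prod.fst ∘ γ) (c₂ := extChartAt I₂ (γ t).2 ∘ Prod.snd ∘ γ)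
    (isMetricOn_inChart gF (γ t).2) (mem_extChartAt_target (I := I₂) (γ t).2)
    (hfx.differentiableAt (by simp)) (hpos _).ne' (hc₁.differentiableAt (by simp)).hasDerivAt
    (hc₂.differentiableAt (by simp))
    ((CoordMetric.contDiffAt_deriv hc₂).differentiableAt (by simp)).hasDerivAt e
  refine hQ.congr_of_eventuallyEq ?_
  filter_upwards [hγ₁.continuous.continuousAt.preimage_mem_nhds
      (extChartAt_source_mem_nhds (I := I₁) (γ t).1),
    hγ₂.continuous.continuousAt.preimage_mem_nhds
      (extChartAt_source_mem_nhds (I := I₂) (γ t).2)] with s h₁ h₂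
  have e1 : (f ∘ (extChartAt I₁ (γ t).1).symm) ((extChartAt I₁ (γ t).1 ∘ Prod.fst ∘ γ) s) =
      f (γ s).1 := congrArg f ((extChartAt I₁ (γ t).1).left_inv h₁)
  have e2 := inChart_mfderiv gF h₂ (velocity I₂ (Prod.snd ∘ γ) s) (velocity I₂ (Prod.snd ∘ γ) s)
  rw [mfderiv_extChartAt_velocity ((hγ₂ s).mdifferentiableAt (by simp)) h₂] at e2
  rw [e1, fibreEnergy]
  exact congrArg (f (γ s).1 ^ 4 * ·) e2.symm

/-- The conserved energy starts at zero, and `f⁴ > 0` with `g_F` positive definite forces the fibre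
velocity to vanish. This replaces an appeal to uniqueness of geodesics. -/
theorem IsGeodesic.velocity_snd_eq_zero (hγ : IsGeodesic (warpedMetric gB f hf hpos gF) γ)
    (h0 : velocity I₂ (Prod.snd ∘ γ) 0 = 0) (t : ℝ) : velocity I₂ (Prod.snd ∘ γ) t = 0 := by
  have h1 : fibreEnergy f gF γ t = fibreEnergy f gF γ 0 :=
    is_const_of_deriv_eq_zero (fun s => (hγ.hasDerivAt_fibreEnergy s).differentiableAt)
      (fun s => (hγ.hasDerivAt_fibreEnergy s).deriv) t 0
  have h2 : fibreEnergy f gF γ 0 = 0 := by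
    have h3 : gF.inner (γ 0).2 (velocity I₂ (Prod.snd ∘ γ) 0) (velocity I₂ (Prod.snd ∘ γ) 0) = 0 :=
      (congrArg (fun w => gF.inner (γ 0).2 w w) h0).trans (map_zero _)
    rw [fibreEnergy, h3, mul_zero]
  rw [h2, fibreEnergy] at h1
  by_contra hne
  exact (mul_pos (pow_pos (hpos _) 4) (gF.pos _ _ hne)).ne' h1

/-- If `f` has zero Hessian, then `f` is affine along geodesics with horizontal initial velocity. -/
theorem IsGeodesic.deriv_deriv_eq_zero (hγ : IsGeodesic (warpedMetric gB f hf hpos gF) γ)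
    (h0 : velocity I₂ (Prod.snd ∘ γ) 0 = 0)
    (hess : ∀ x (u : TangentSpace I₁ x), hessian gB f x u u = 0) (t : ℝ) :
    HasDerivAt (deriv (f ∘ Prod.fst ∘ γ)) 0 t := by
  have hγ₁ := contMDiff_fst.comp hγ.1
  have hγ₂ := contMDiff_snd.comp hγ.1
  have hc₁ := contDiffAt_extChartAt_comp hγ₁ t
  have e := (hγ.warped_components t).1
  have hv : deriv (extChartAt I₂ (γ t).2 ∘ Prod.snd ∘ γ) t = 0 := by
    have h1 := mfderiv_extChartAt_velocity (p := (γ t).2) ((hγ₂ t).mdifferentiableAt (by simp))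
      (mem_extChartAt_source (I := I₂) (γ t).2)
    rw [hγ.velocity_snd_eq_zero h0 t] at h1
    exact h1.symm.trans (map_zero _)
  simp only [hv, map_zero, zero_smul, sub_zero] at e
  have h2 := CoordMetric.hasDerivAt_deriv_comp_geodesic
    (contDiffAt_comp_extChartAt_symm hf (γ t).1) hc₁ e
  have h3 := hessian_eq_coord gB f (γ t).1
    (deriv (extChartAt I₁ (γ t).1 ∘ Prod.fst ∘ γ) t)
    (deriv (extChartAt I₁ (γ t).1 ∘ Prod.fst ∘ γ) t)
  have h4 := h2.congr_deriv (h3.symm.trans (hess _ _))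
  refine h4.congr_of_eventuallyEq (Filter.EventuallyEq.deriv ?_)
  filter_upwards [hγ₁.continuous.continuousAt.preimage_mem_nhds
      (extChartAt_source_mem_nhds (I := I₁) (γ t).1)] with s h₁
  exact (congrArg f ((extChartAt I₁ (γ t).1).left_inv h₁)).symm

/-- A warped product with a nonconstant positive warping function of zero Hessian is not
geodesically complete. -/
theorem not_isGeodesicallyComplete_of_hessian_eq_zero [ConnectedSpace B] [Nonempty F]
    (hconst : ¬ ∃ c : ℝ, ∀ x, f x = c)
    (hess : ∀ x (u : TangentSpace I₁ x), hessian gB f x u u = 0) :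
    ¬ IsGeodesicallyComplete (warpedMetric gB f hf hpos gF) := by
  intro hcomp
  obtain ⟨x₀, u, hu⟩ := exists_differential_ne_zero hf hconst
  obtain ⟨y₀⟩ := ‹Nonempty F›
  -- The initial velocity is horizontal, and `f` has nonzero derivative in its direction.
  obtain ⟨γ, hγ, hv⟩ := hcomp (⟨(x₀, y₀), ((u, 0) : E₁ × E₂)⟩ : TangentBundle (I₁.prod I₂) (B × F))
  have hγd := (hγ.1 0).mdifferentiableAt (by simp)
  have hF : ContMDiff (I₁.prod I₂) 𝓘(ℝ, ℝ) ∞ (f ∘ Prod.fst : B × F → ℝ) := hf.comp contMDiff_fst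
  have h1 : deriv (f ∘ Prod.fst ∘ γ) 0 = differential I₁ f x₀ u := by
    have e1 := deriv_comp_eq_differential ((hF (γ 0)).mdifferentiableAt (by simp)) hγd
    have e2 := congrArg (fun w : TangentBundle (I₁.prod I₂) (B × F) =>
      differential (I₁.prod I₂) (f ∘ Prod.fst : B × F → ℝ) w.proj w.2) hv
    exact e1.trans (e2.trans (differential_horizontal hF x₀ y₀ u))
  have h2 : velocity I₂ (Prod.snd ∘ γ) 0 = 0 := by
    have e1 := velocity_comp (I' := I₂) (mdifferentiableAt_snd (I := I₁) (I' := I₂) (x := γ 0)) hγd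
    rw [mfderiv_snd] at e1
    have e2 := congrArg (fun w : TangentBundle (I₁.prod I₂) (B × F) => (w.2 : E₁ × E₂).2) hv
    exact e1.trans e2
  have h3 := hγ.deriv_deriv_eq_zero h2 hess
  set k := f ∘ Prod.fst ∘ γ with hk
  have h4 (t : ℝ) : deriv k t = differential I₁ f x₀ u :=
    (is_const_of_deriv_eq_zero (fun s => (h3 s).differentiableAt) (fun s => (h3 s).deriv) t 0).trans
      h1
  set c := differential I₁ f x₀ u
  have hkd : Differentiable ℝ k :=
    (contMDiff_iff_contDiff.1 (hf.comp (contMDiff_fst.comp hγ.1))).differentiable (by simp)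
  have h5 (t : ℝ) : HasDerivAt (fun s => k s - c * s) 0 t := by
    have := (hkd t).hasDerivAt.sub ((hasDerivAt_id t).const_mul c)
    rw [h4] at this
    simpa using! this
  -- Along the geodesic `f` equals `k 0 + c t`, whose zero is `t = -k 0 / c`; completeness
  -- guarantees that this time is reached.
  have h6 := is_const_of_deriv_eq_zero (fun s => (h5 s).differentiableAt) (fun s => (h5 s).deriv)
    (-k 0 / c) 0
  have h7 : k (-k 0 / c) = 0 := by
    have h8 : c * (-k 0 / c) = -k 0 := mul_div_cancel₀ _ hu
    linarith
  exact (hpos _).ne' h7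

end WarpedGeodesic

end Riem
-- The theorem
theorem proposition1 {n m : ℕ}
    {B : Type*} [TopologicalSpace B] [T2Space B] [SecondCountableTopology B] [ConnectedSpace B]
    [ChartedSpace (EuclideanSpace ℝ (Fin n)) B] [IsManifold (𝓡 n) ∞ B]
    {F : Type*} [TopologicalSpace F] [T2Space F] [SecondCountableTopology F] [ConnectedSpace F]
    [ChartedSpace (EuclideanSpace ℝ (Fin m)) F] [IsManifold (𝓡 m) ∞ F]
    (gB : Riem.Metric (𝓡 n) B) (gF : Riem.Metric (𝓡 m) F)
    (f : B → ℝ) (hf : ContMDiff (𝓡 n) 𝓘(ℝ, ℝ) ∞ f) (hpos : ∀ x, 0 < f x)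
    (hconst : ¬ ∃ c : ℝ, ∀ x, f x = c)
    (α β μ ρ : ℝ) (hβ : β ≠ 0) (h lam : B × F → ℝ)
    (hE : Riem.IsGradientEinsteinType (Riem.warpedMetric gB f hf hpos gF) α β μ ρ h lam) :
    (μ = 0 →
      (Riem.IsLiftOfSmooth (𝓡 n) h ↔
        Riem.IsLiftOfSmooth (𝓡 n)
          (fun p : B × F => ρ * Riem.scalar gF p.2 + lam p * f p.1 ^ 2))) ∧
    (μ ≠ 0 → Riem.IsLiftOfSmooth (𝓡 n) h →
      Riem.IsLiftOfSmooth (𝓡 n)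
        (fun p : B × F => ρ * Riem.scalar gF p.2 + lam p * f p.1 ^ 2)) := by
  refine ⟨fun hμ => ⟨hE.isLiftOfSmooth_soliton hconst, fun hlift => ?_⟩,
    fun _ => hE.isLiftOfSmooth_soliton hconst⟩
  subst hμ
  obtain ⟨y₀⟩ : Nonempty F := inferInstance
  obtain ⟨ψ, hψ⟩ := hE.exists_potential_eq hβ y₀
  -- Either `h` equals its slice at `y₀`, or some nonzero `ψ y₁` forces `f` to have zero Hessian,
  -- which completeness excludes.
  by_cases hψ0 : ∀ y, ψ y = 0
  · refine ⟨fun x => h (x, y₀), ?_, fun x y => ?_⟩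
    · exact hE.smooth_potential.comp (contMDiff_id.prodMk contMDiff_const)
    · rw [hψ x y, hψ0 y, mul_zero, add_zero]
  · push Not at hψ0
    obtain ⟨y₁, hy₁⟩ := hψ0
    exact absurd hE.complete (Riem.not_isGeodesicallyComplete_of_hessian_eq_zero hconst
      (hE.hessian_eq_zero hβ hlift hψ hy₁))
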